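/- **Conventions.** Let $\Gamma=(m_{i,j})_{i,j\in I}$ be a Coxeter matrix over an arbitrary (possibly infinite) set $I$, with $m_{i,j}\in\mathbb N_{\ge 1}\cup\{\infty\}$. Write $\prod_m(x,y)=xyxy\cdots$ ($m$ factors). Let $W_\Gamma$ be the Coxeter group of $\Gamma$, with generators $s_i$ and standard length $\ell$, and let $B^+_\Gamma$ (resp. $B_\Gamma$) be the Artin–Tits monoid (resp. group), generated by elements $\mathbf s_i$, $i\in I$, with relations $\prod_{m_{i,j}}(\mathbf s_i,\mathbf s_j)=\prod_{m_{i,j}}(\mathbf s_j,\mathbf s_i)$ whenever $m_{i,j}\ne\infty$. For $w\in W_\Gamma$, let $\mathbf w\in B^+_\Gamma$ be the element represented by any reduced word of $w$. For $J\subseteq I$ let $\Gamma_J=(m_{i,j})_{i,j\in J}$ and $W_J=\langle s_j\mid j\in J\rangle$; $J$ is spherical if $W_J$ is finite, and then $r_J$ denotes the element of maximal length of $W_J$ and $\mathbf r_J$ the corresponding element of $B^+_\Gamma$ (and also its canonical image in $B_\Gamma$). A partition $\tilde I$ of $I$ into non-empty blocks is *admissible* with respect to $\Gamma$ if all its blocks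 are spherical and if, for every $w$ in the subgroup $\langle r_\alpha\mid\alpha\in\tilde I\rangle$ of $W_\Gamma$ and every $\alpha\in\tilde I$, either $\ell(ws_i)=\ell(w)+1$ for all $i\in\alpha$, or $\ell(ws_i)=\ell(w)-1$ for all $i\in\alpha$. Its *type* is the matrix $(|r_\alpha r_\beta|)_{\alpha,\beta\in\tilde I}$ of orders of the products $r_\alpha r_\beta$ in $W_\Gamma$. A morphism $\varphi:B^+_{\Gamma'}\to B^+_\Gamma$ (resp. $\varphi:B_{\Gamma'}\to B_\Gamma$) is *admissible* if there are a subset $J\subseteq I$ and an admissible partition $J'$ of $J$ with respect to $\Gamma_J$, whose type is $\Gamma'$ (the index set $I'$ of $\Gamma'$ being identified with $J'$ by a bijection $a\mapsto p(a)$), such that $\varphi(\mathbf s_a)=\mathbf r_{p(a)}$ for all $a\in I'$; one says that $\varphi$ is *induced* by this partition. **Corollary.** Let $\Gamma,\Gamma',\Gamma''$ be Coxeter matrices over $I,I',I''$, and let $\varphi:B^+_{\Gamma'}\to B^+_\Gamma$ and $\varphi':B^+_{\Gamma''}\to B^+_{\Gamma'}$ (resp. $\varphi:B_{\Gamma'}\to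 B_\Gamma$ and $\varphi':B_{\Gamma''}\to B_{\Gamma'}$) be admissible morphisms. Then $\varphi\circ\varphi'$ is an admissible morphism. More precisely, if $\varphi$ is induced by the admissible partition with blocks $p(a)\subseteq I$ ($a\in I'$), and $\varphi'$ by the admissible partition with blocks $q(c)\subseteq I'$ ($c\in I''$), then the sets $\bigcup_{a\in q(c)}p(a)$, $c\in I''$, are the blocks of an admissible partition of their union $K\subseteq I$ with respect to $\Gamma_K$, of type $\Gamma''$, and $\varphi\circ\varphi'$ is induced by this partition. -/

import Mathlib

/-! Coxeter matrices are Mathlib's: natural-number entries, with `0` standing for `∞` (the same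
convention as that of `orderOf`).  For `M : CoxeterMatrix I`, `M.Group` is the Coxeter group,
`M.simple i` its standard generator at `i`, and `M.toCoxeterSystem.length` its standard length. -/

/-- `altProd n x y` is the product `x * y * x * y * ⋯` of `n` factors, starting with `x`. -/
def altProd {N : Type*} [Monoid N] : ℕ → N → N → N
  | 0, _, _ => 1
  | n + 1, x, y => x * altProd n y x

theorem map_altProd {N N' : Type*} [Monoid N] [Monoid N'] (f : N →* N') (n : ℕ) (x y : N) :
    f (altProd n x y) = altProd n (f x) (f y) := by
  induction n generalizing x y with
  | zero => simp [altProd]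
  | succ n ih => simp [altProd, ih]

namespace CoxeterMatrix

/-! ### Artin–Tits monoids and groups -/

/-- The defining relations of the Artin–Tits monoid: `s_i s_j s_i ⋯ = s_j s_i s_j ⋯` with `m_{i,j}`
factors on both sides, whenever `m_{i,j}` is finite. -/
inductive ArtinRel {I : Type*} (M : CoxeterMatrix I) : FreeMonoid I → FreeMonoid I → Prop
  | braid (i j : I) (h : M i j ≠ 0) :
      ArtinRel M (altProd (M i j) (FreeMonoid.of i) (FreeMonoid.of j))
        (altProd (M i j) (FreeMonoid.of j) (FreeMonoid.of i))

/-- The Artin–Tits monoid `B⁺_Γ`. -/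
abbrev ArtinMonoid {I : Type*} (M : CoxeterMatrix I) : Type _ := PresentedMonoid M.ArtinRel

/-- The standard generators of the Artin–Tits monoid. -/
def artinGen {I : Type*} (M : CoxeterMatrix I) (i : I) : M.ArtinMonoid :=
  PresentedMonoid.of M.ArtinRel i

/-- The defining relators of the Artin–Tits group (the same braid relations). -/
def artinGroupRels {I : Type*} (M : CoxeterMatrix I) : Set (FreeGroup I) :=
  {g | ∃ i j : I, M i j ≠ 0 ∧
    g = altProd (M i j) (FreeGroup.of i) (FreeGroup.of j) *
      (altProd (M i j) (FreeGroup.of j) (FreeGroup.of i))⁻¹}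

/-- The Artin–Tits group `B_Γ`. -/
abbrev ArtinGroup {I : Type*} (M : CoxeterMatrix I) : Type _ := PresentedGroup M.artinGroupRels

/-- The standard generators of the Artin–Tits group. -/
def artinGroupGen {I : Type*} (M : CoxeterMatrix I) (i : I) : M.ArtinGroup :=
  PresentedGroup.of i

theorem artinGroupGen_braid {I : Type*} (M : CoxeterMatrix I) (i j : I) (h : M i j ≠ 0) :
    altProd (M i j) (M.artinGroupGen i) (M.artinGroupGen j) =
      altProd (M i j) (M.artinGroupGen j) (M.artinGroupGen i) := by
  have key : PresentedGroup.mk M.artinGroupRels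
      (altProd (M i j) (FreeGroup.of i) (FreeGroup.of j) *
        (altProd (M i j) (FreeGroup.of j) (FreeGroup.of i))⁻¹) = 1 :=
    PresentedGroup.one_of_mem ⟨i, j, h, rfl⟩
  rw [map_mul, map_inv, mul_inv_eq_one, map_altProd, map_altProd] at key
  exact key

/-- The canonical morphism `B⁺_Γ → B_Γ`, which sends each standard generator to the standard
generator with the same index. -/
def artinMonoidToGroup {I : Type*} (M : CoxeterMatrix I) : M.ArtinMonoid →* M.ArtinGroup :=
  PresentedMonoid.lift M.artinGroupGen (by
    rintro _ _ ⟨i, j, h⟩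
    rw [map_altProd, map_altProd, FreeMonoid.lift_eval_of, FreeMonoid.lift_eval_of]
    exact M.artinGroupGen_braid i j h)

/-! ### Parabolic subgroups, longest elements, simple elements -/

/-- The Coxeter matrix `Γ_J`, for a subset `J` of the index set. -/
def restrict {I : Type*} (M : CoxeterMatrix I) (J : Set I) : CoxeterMatrix J where
  M := fun i j => M i j
  isSymm := Matrix.IsSymm.ext fun i j => M.symmetric j i
  diagonal := fun i => M.diagonal i
  off_diagonal := fun i j h => M.off_diagonal i j fun h' => h (Subtype.ext h')

/-- The standard length on the Coxeter group. -/
noncomputable def len {I : Type*} (M : CoxeterMatrix I) (w : M.Group) : ℕ :=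
  M.toCoxeterSystem.length w

/-- The standard parabolic subgroup `W_J`, generated by the `s_j` with `j ∈ J`. -/
def parabolic {I : Type*} (M : CoxeterMatrix I) (J : Set I) : Subgroup M.Group :=
  Subgroup.closure (M.simple '' J)

/-- `J` is spherical when `W_J` is finite. -/
def IsSpherical {I : Type*} (M : CoxeterMatrix I) (J : Set I) : Prop :=
  Finite (M.parabolic J)

/-- The element `r_J` of maximal standard length in `W_J`.  It exists, and is unique, when `J` is
spherical; only that case is used. -/
noncomputable def longest {I : Type*} (M : CoxeterMatrix I) (J : Set I) : M.Group :=
  Classical.epsilon fun w => w ∈ M.parabolic J ∧ ∀ v ∈ M.parabolic J, M.len v ≤ M.len w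

theorem longest_spec {I : Type*} (M : CoxeterMatrix I) {J : Set I} (hJ : M.IsSpherical J) :
    M.longest J ∈ M.parabolic J ∧ ∀ v ∈ M.parabolic J, M.len v ≤ M.len (M.longest J) := by
  have hfin : Finite (M.parabolic J) := hJ
  obtain ⟨w, hw⟩ := Finite.exists_max fun v : M.parabolic J => M.len v.1
  exact Classical.epsilon_spec
    (p := fun w => w ∈ M.parabolic J ∧ ∀ v ∈ M.parabolic J, M.len v ≤ M.len w)
    ⟨w.1, w.2, fun v hv => hw ⟨v, hv⟩⟩

/-- The section `W_Γ → B⁺_Γ` whose image consists of the simple elements: `w` is sent to the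
element of `B⁺_Γ` represented by a reduced word of `w` (all reduced words of `w` give the same
element). -/
noncomputable def simpleElt {I : Type*} (M : CoxeterMatrix I) (w : M.Group) : M.ArtinMonoid :=
  ((M.toCoxeterSystem.exists_isReduced w).choose.map M.artinGen).prod

/-- The element of `B⁺_Γ` that lifts the longest element `r_J` of `W_J`. -/
noncomputable def artinLongest {I : Type*} (M : CoxeterMatrix I) (J : Set I) : M.ArtinMonoid :=
  M.simpleElt (M.longest J)

/-! ### Admissible partitions -/

/-- `I⁺(w)`. -/
def ascents {I : Type*} (M : CoxeterMatrix I) (w : M.Group) : Set I :=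
  {i | M.len (w * M.simple i) = M.len w + 1}

/-- `I⁻(w)`. -/
def descents {I : Type*} (M : CoxeterMatrix I) (w : M.Group) : Set I :=
  {i | M.len (w * M.simple i) + 1 = M.len w}

/-- A spherical partition of `Γ`: a partition of `I` into non-empty spherical blocks. -/
structure IsSphericalPartition {I : Type*} (M : CoxeterMatrix I) (P : Set (Set I)) : Prop where
  isPartition : Setoid.IsPartition P
  spherical : ∀ α ∈ P, M.IsSpherical α

/-- The subgroup of `W_Γ` generated by the `r_α`, `α ∈ P`. -/
def partitionSubgroup {I : Type*} (M : CoxeterMatrix I) (P : Set (Set I)) : Subgroup M.Group :=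
  Subgroup.closure (M.longest '' P)

/-- An admissible partition of `Γ`. -/
structure IsAdmissiblePartition {I : Type*} (M : CoxeterMatrix I) (P : Set (Set I)) : Prop
    extends M.IsSphericalPartition P where
  ascents_or_descents : ∀ w ∈ M.partitionSubgroup P, ∀ α ∈ P,
    α ⊆ M.ascents w ∨ α ⊆ M.descents w

/-- The type of a partition: the matrix of the orders of the products `r_α r_β` in `W_Γ`. -/
noncomputable def partitionType {I : Type*} (M : CoxeterMatrix I) (P : Set (Set I)) :
    Matrix P P ℕ :=
  fun α β => orderOf (M.longest α * M.longest β)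

/-! ### Admissible morphisms -/

/-- The block `p a`, viewed as a subset of the union `J` of all the blocks. -/
def block {I I' : Type*} (p : I' → Set I) (a : I') : Set (⋃ b, p b : Set I) :=
  Subtype.val ⁻¹' p a

/-- The blocks `p a`, `a ∈ I'`, are pairwise distinct and form an admissible partition of `Γ_J`,
where `J ⊆ I` is their union, and `a ↦ p a` identifies `Γ'` with the type of this partition. -/
structure IsAdmissibleFamily {I I' : Type*} (M' : CoxeterMatrix I') (M : CoxeterMatrix I)
    (p : I' → Set I) : Prop where
  injective : Function.Injective p
  admissible : (M.restrict (⋃ a, p a)).IsAdmissiblePartition (Set.range (block p))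
  type_eq : ∀ a b : I', M' a b =
    (M.restrict (⋃ a, p a)).partitionType (Set.range (block p))
      ⟨block p a, a, rfl⟩ ⟨block p b, b, rfl⟩

/-- `φ : B⁺_{Γ'} → B⁺_Γ` is the morphism induced by the admissible partition with blocks `p a`:
it sends the generator `s_a` to the lift of the longest element of `W_{p a}`. -/
structure IsInducedBy {I I' : Type*} {M' : CoxeterMatrix I'} {M : CoxeterMatrix I}
    (φ : M'.ArtinMonoid →* M.ArtinMonoid) (p : I' → Set I) : Prop where
  family : M'.IsAdmissibleFamily M p
  map_gen : ∀ a : I', φ (M'.artinGen a) = M.artinLongest (p a)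

/-- Admissible morphisms between Artin–Tits monoids. -/
def IsAdmissibleHom {I I' : Type*} {M' : CoxeterMatrix I'} {M : CoxeterMatrix I}
    (φ : M'.ArtinMonoid →* M.ArtinMonoid) : Prop :=
  ∃ p : I' → Set I, IsInducedBy φ p

/-- `φ : B_{Γ'} → B_Γ` is the group morphism induced by the admissible partition with blocks
`p a`. -/
structure IsGroupInducedBy {I I' : Type*} {M' : CoxeterMatrix I'} {M : CoxeterMatrix I}
    (φ : M'.ArtinGroup →* M.ArtinGroup) (p : I' → Set I) : Prop where
  family : M'.IsAdmissibleFamily M p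
  map_gen : ∀ a : I',
    φ (M'.artinGroupGen a) = M.artinMonoidToGroup (M.artinLongest (p a))

/-- Admissible morphisms between Artin–Tits groups. -/
def IsAdmissibleGroupHom {I I' : Type*} {M' : CoxeterMatrix I'} {M : CoxeterMatrix I}
    (φ : M'.ArtinGroup →* M.ArtinGroup) : Prop :=
  ∃ p : I' → Set I, IsGroupInducedBy φ p

end CoxeterMatrix

/-! An admissible family `p` defines a morphism `f` of Coxeter groups sending `s_a` to `r_{p a}`; it
exists because the type prescribes the orders of the products of two generators. The heart of the
proof is that `f` respects descents: if `a` is an ascent (resp. a descent) of `w`, then every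
element of `p a` is an ascent (resp. a descent) of `f w`.

Everything else follows from this. A non-trivial `w` has a descent, so `f w ≠ 1` and `f` is
injective: orders of products are preserved. An element of a parabolic subgroup whose descents
contain all the generators of that subgroup is its longest element, so `f` sends `r_J` to the
longest element of the union of the blocks `p a`, `a ∈ J`. The subgroup attached to the composed
family is therefore the image under `f` of the one attached to `q`, and the ascent-descent
alternative passes from one to the other. Lengths also add along the image of a reduced word, so by
Matsumoto's theorem the same computation holds for the lifts in the Artin–Tits monoid, and then in
the group.

To prove the statement on ascents, write `w = v u` with `u` in the dihedral subgroup of `a` and of a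
descent `b` of `w`, and with `a`, `b` ascents of `v`. Induction on the length handles `v` and leaves
the alternating element `u`. If `p a` passed from ascents to descents when a letter is put in front
of an alternating word, `longest_mul_eq_mul_longest` would identify the images of the two
alternating words of the same length, which the order of `r_{p a} r_{p b}` forbids.

The definitions speak of `Γ_J`, with `J` the union of the blocks. The same theory, applied to the
singletons of `J`, embeds `W_{Γ_J}` in `W_Γ`, and `isAdmissibleFamily_iff` then removes `J` from the
statement. This embedding needs `s_i s_j` to have order exactly `m_{i,j}`, which the geometric
representation provides; the combinatorics of words rests on the exchange condition. -/

namespace CoxeterMatrix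

/-! ### The geometric representation and the orders of the products of two generators -/

section GeometricRepresentation

open Module Polynomial.Chebyshev

variable {I : Type*} (M : CoxeterMatrix I)

/-- The linear form `v ↦ 2 B(e_i, v)` of the geometric representation. -/
noncomputable def geomForm (i : I) : Dual ℝ (I →₀ ℝ) :=
  Finsupp.linearCombination ℝ fun j => -(2 * Real.cos (Real.pi / M i j))

theorem geomForm_single (i j : I) :
    M.geomForm i (Finsupp.single j 1) = -(2 * Real.cos (Real.pi / M i j)) := by
  simp [geomForm]

theorem geomForm_self (i : I) : M.geomForm i (Finsupp.single i 1) = 2 := by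
  simp [geomForm_single]

/-- The reflections of the geometric representation. -/
noncomputable def geomReflection (i : I) : (I →₀ ℝ) ≃ₗ[ℝ] (I →₀ ℝ) :=
  reflection (M.geomForm_self i)

/-- This is the parameter `t = 2 cos θ`, with `θ = 2π/m`, at which Chebyshev polynomials express the
powers of a product of two reflections. -/
theorem geomForm_mul_geomForm (i j : I) :
    M.geomForm i (Finsupp.single j 1) * M.geomForm j (Finsupp.single i 1) - 2 =
      2 * Real.cos (2 * (Real.pi / M i j)) := by
  rw [geomForm_single, geomForm_single, M.symmetric j i, Real.cos_two_mul]
  ring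

theorem sin_two_pi_div_ne_zero {m : ℕ} (hm : 3 ≤ m) : Real.sin (2 * (Real.pi / m)) ≠ 0 := by
  have hm' : (3 : ℝ) ≤ m := by exact_mod_cast hm
  refine (Real.sin_pos_of_pos_of_lt_pi (by positivity) ?_).ne'
  rw [← mul_div_assoc, div_lt_iff₀ (by linarith)]
  nlinarith [Real.pi_pos]

/-- The coefficients of the powers of a product of two reflections are values `S_n(2 cos θ) =
sin((n+1)θ) / sin θ`, and the relevant ones vanish because `mθ = 2π`. When `m = 2` the denominator
is zero, and the two commuting reflections are treated directly. -/
theorem geomReflection_isLiftable : M.IsLiftable M.geomReflection := by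
  intro i j
  have ht := M.geomForm_mul_geomForm i j
  rcases eq_or_ne i j with rfl | hij
  · rw [M.diagonal, pow_one]
    ext1 v
    exact involutive_reflection (M.geomForm_self i) v
  obtain hm | hm | hm : M i j = 0 ∨ M i j = 2 ∨ 3 ≤ M i j := by
    have := M.off_diagonal i j hij
    omega
  · rw [hm, pow_zero]
  · have h1 : M.geomForm i (Finsupp.single j 1) = 0 := by
      simp [geomForm_single, hm]
    have h2 : M.geomForm j (Finsupp.single i 1) = 0 := by
      simp [geomForm_single, M.symmetric j i, hm]
    ext1 v
    rw [hm, pow_two]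
    simp only [geomReflection, LinearEquiv.mul_apply, reflection_apply, map_sub, map_smul, h1, h2,
      geomForm_self, LinearEquiv.coe_one, id_eq]
    module
  · set θ := 2 * (Real.pi / M i j) with hθ
    have hs : Real.sin θ ≠ 0 := sin_two_pi_div_ne_zero hm
    have hS : ∀ n : ℤ, (S ℝ n).eval (2 * Real.cos θ) = Real.sin ((n + 1) * θ) / Real.sin θ :=
      fun n => by rw [eq_div_iff hs, S_two_mul_real_cos]
    have hmθ : (M i j : ℝ) * θ = 2 * Real.pi := by
      have : (M i j : ℝ) ≠ 0 := by positivity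
      rw [hθ]; field_simp
    ext1 v
    rw [geomReflection, geomReflection,
      reflection_mul_reflection_pow_apply _ _ _ _ _ ht.symm]
    -- The indices in the formula are halves rounded down. For `m = 2k`, `kθ = π` kills `S_{k-1}`;
    -- for `m = 2k+1`, `(k+1)θ = 2π - kθ` gives `S_k + S_{k-1} = 0`.
    rcases Nat.even_or_odd' (M i j) with ⟨k, hk | hk⟩
    · have e1 : ((M i j : ℤ) - 2) / 2 = k - 1 := by omega
      have e2 : ((M i j : ℤ) - 1) / 2 = k - 1 := by omega
      have hz : (S ℝ ((k : ℤ) - 1)).eval (2 * Real.cos θ) = 0 := by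
        rw [hS]
        have : (((k : ℤ) - 1 : ℤ) + 1 : ℝ) * θ = Real.pi := by
          rw [hk] at hmθ; push_cast at hmθ ⊢; linarith
        rw [this, Real.sin_pi, zero_div]
      rw [e1, e2, hz]
      simp
    · have e1 : ((M i j : ℤ) - 2) / 2 = k - 1 := by omega
      have e2 : ((M i j : ℤ) - 1) / 2 = k := by omega
      have e3 : ((M i j : ℤ) - 3) / 2 = k - 1 := by omega
      have e4 : (M i j : ℤ) / 2 = k := by omega
      have hz : (S ℝ (k : ℤ)).eval (2 * Real.cos θ) +
          (S ℝ ((k : ℤ) - 1)).eval (2 * Real.cos θ) = 0 := by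
        rw [hS, hS, ← add_div]
        have : (((k : ℤ) : ℝ) + 1) * θ = 2 * Real.pi - (((k : ℤ) - 1 : ℤ) + 1 : ℝ) * θ := by
          rw [hk] at hmθ; push_cast at hmθ ⊢; linarith
        rw [this, Real.sin_two_pi_sub, neg_add_cancel, zero_div]
      rw [e1, e2, e3, e4, hz]
      simp

/-- Apply the power to `e_i` and compare coordinates: `S_k + S_{k-1} = 1` along `e_i`, and `S_{k-1}
cos(π/m) = 0` along `e_j`. For `m ≥ 3` this says `sin kθ = 0` and `cos kθ = 1`, so `kθ` is a
multiple of `2π`. -/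
theorem dvd_of_geomReflection_pow_eq_one {i j : I} (hij : i ≠ j) {k : ℕ}
    (h : (M.geomReflection i * M.geomReflection j) ^ k = 1) : M i j ∣ k := by
  have ht := M.geomForm_mul_geomForm i j
  have key := congrArg (fun f : (I →₀ ℝ) ≃ₗ[ℝ] (I →₀ ℝ) => f (Finsupp.single i 1)) h
  simp only [geomReflection] at key
  rw [reflection_mul_reflection_pow_apply_self _ _ _ _ ht.symm, M.geomForm_single j i,
    M.symmetric j i] at key
  have k1 := DFunLike.congr_fun key i
  have k2 := DFunLike.congr_fun key j
  simp [hij, hij.symm] at k1 k2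
  set θ := 2 * (Real.pi / M i j) with hθ
  obtain hm | hm | hm : M i j = 0 ∨ M i j = 2 ∨ 3 ≤ M i j := by
    have := M.off_diagonal i j hij
    omega
  -- Division by zero gives `π / 0 = 0`, so `θ = 0`, the right value for `m = ∞`; then `S_{k-1}(2) =
  -- k` must vanish.
  · simp [hθ, hm, S_eval_two] at k2
    simp [k2]
  · have h2 : 2 * Real.cos θ = -2 := by
      have : θ = Real.pi := by rw [hθ, hm]; push_cast; ring
      rw [this]; simp
    rw [h2, S_eval_neg_two, S_eval_neg_two] at k1
    rw [hm]
    by_contra hk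
    rw [← even_iff_two_dvd, Nat.not_even_iff_odd] at hk
    have hk' : Odd (k : ℤ) := by exact_mod_cast hk
    rw [Int.negOnePow_odd _ hk', Int.negOnePow_even _ (by simpa using hk'.sub_odd odd_one)] at k1
    push_cast at k1
    linarith
  · have hs : Real.sin θ ≠ 0 := sin_two_pi_div_ne_zero hm
    have hm' : (3 : ℝ) ≤ M i j := by exact_mod_cast hm
    have hS : ∀ n : ℤ, (S ℝ n).eval (2 * Real.cos θ) = Real.sin ((n + 1) * θ) / Real.sin θ :=
      fun n => by rw [eq_div_iff hs, S_two_mul_real_cos]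
    have hc : Real.cos (Real.pi / M i j) ≠ 0 := by
      refine (Real.cos_pos_of_mem_Ioo ⟨?_, ?_⟩).ne'
      · have : 0 < Real.pi / M i j := by positivity
        linarith [Real.pi_pos]
      · exact div_lt_div_of_pos_left Real.pi_pos two_pos (by linarith)
    have k3 := k2.resolve_right hc
    rw [k3, hS, add_zero, div_eq_one_iff_eq hs] at k1
    rw [hS, div_eq_zero_iff, or_iff_left hs] at k3
    push_cast at k1 k3
    rw [sub_add_cancel] at k3
    rw [add_mul, one_mul, Real.sin_add, k3, zero_mul, zero_add, mul_eq_right₀ hs,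
      Real.cos_eq_one_iff] at k1
    obtain ⟨n, hn⟩ := k1
    have : (k : ℤ) = M i j * n := by
      have hpi := Real.pi_ne_zero
      rw [hθ] at hn
      field_simp at hn
      have : (M i j : ℝ) * n = k := by linarith
      exact_mod_cast this.symm
    exact Int.natCast_dvd_natCast.mp ⟨n, this⟩

/-- The order of the product of two standard generators is the corresponding entry of the Coxeter
matrix. -/
theorem orderOf_simple_mul_simple (i j : I) : orderOf (M.simple i * M.simple j) = M i j := by
  refine Nat.dvd_antisymm (orderOf_dvd_of_pow_eq_one
    (M.toCoxeterSystem.simple_mul_simple_pow i j)) ?_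
  rcases eq_or_ne i j with rfl | hij
  · simp
  refine M.dvd_of_geomReflection_pow_eq_one hij ?_
  have := congrArg (M.toCoxeterSystem.lift ⟨_, M.geomReflection_isLiftable⟩)
    (pow_orderOf_eq_one (M.simple i * M.simple j))
  rwa [map_pow, map_mul, ← toCoxeterSystem_simple, CoxeterSystem.lift_apply_simple,
    CoxeterSystem.lift_apply_simple, map_one] at this

theorem simple_injective : Function.Injective M.simple := by
  intro i j h
  by_contra hij
  have h1 := M.orderOf_simple_mul_simple i j
  rw [h, ← toCoxeterSystem_simple, CoxeterSystem.simple_mul_simple_self, orderOf_one] at h1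
  exact M.off_diagonal i j hij h1.symm

end GeometricRepresentation

end CoxeterMatrix

namespace CoxeterMatrix

/-! ### Words and lengths -/

section Words

variable {I : Type*} (M : CoxeterMatrix I)

/-- The element of the Coxeter group represented by a word. -/
def word (ω : List I) : M.Group := (ω.map M.simple).prod

@[simp] theorem word_nil : M.word [] = 1 := rfl

@[simp] theorem word_cons (i : I) (ω : List I) : M.word (i :: ω) = M.simple i * M.word ω := by
  simp [word]

@[simp] theorem word_append (ω ω' : List I) : M.word (ω ++ ω') = M.word ω * M.word ω' := by
  simp [word]

theorem word_eq_wordProd (ω : List I) : M.word ω = M.toCoxeterSystem.wordProd ω := rfl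

theorem word_reverse (ω : List I) : M.word ω.reverse = (M.word ω)⁻¹ :=
  M.toCoxeterSystem.wordProd_reverse ω

@[simp] theorem simple_mul_self (i : I) : M.simple i * M.simple i = 1 :=
  M.toCoxeterSystem.simple_mul_simple_self i

@[simp] theorem simple_mul_self_mul (i : I) (w : M.Group) :
    M.simple i * (M.simple i * w) = w := by
  rw [← mul_assoc, simple_mul_self, one_mul]

@[simp] theorem mul_simple_mul_self (i : I) (w : M.Group) :
    w * M.simple i * M.simple i = w := by
  rw [mul_assoc, simple_mul_self, mul_one]

@[simp] theorem simple_inv (i : I) : (M.simple i)⁻¹ = M.simple i :=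
  M.toCoxeterSystem.inv_simple i

@[simp] theorem len_one : M.len 1 = 0 := M.toCoxeterSystem.length_one

@[simp] theorem len_inv (w : M.Group) : M.len w⁻¹ = M.len w := M.toCoxeterSystem.length_inv w

theorem len_eq_zero {w : M.Group} : M.len w = 0 ↔ w = 1 := M.toCoxeterSystem.length_eq_zero_iff

@[simp] theorem len_simple (i : I) : M.len (M.simple i) = 1 := M.toCoxeterSystem.length_simple i

theorem len_mul_le (v w : M.Group) : M.len (v * w) ≤ M.len v + M.len w :=
  M.toCoxeterSystem.length_mul_le v w

theorem len_word_le (ω : List I) : M.len (M.word ω) ≤ ω.length :=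
  M.toCoxeterSystem.length_wordProd_le ω

theorem exists_word (w : M.Group) : ∃ ω, M.word ω = w ∧ M.len (M.word ω) = ω.length := by
  obtain ⟨ω, h1, h2⟩ := M.toCoxeterSystem.exists_isReduced w
  exact ⟨ω, h2.symm, h1⟩

theorem len_mul_simple (w : M.Group) (i : I) :
    M.len (w * M.simple i) = M.len w + 1 ∨ M.len (w * M.simple i) + 1 = M.len w :=
  M.toCoxeterSystem.length_mul_simple w i

theorem mem_ascents {w : M.Group} {i : I} :
    i ∈ M.ascents w ↔ M.len (w * M.simple i) = M.len w + 1 := Iff.rfl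

theorem mem_descents {w : M.Group} {i : I} :
    i ∈ M.descents w ↔ M.len (w * M.simple i) + 1 = M.len w := Iff.rfl

theorem mem_descents_of_lt {w : M.Group} {i : I} (h : M.len (w * M.simple i) < M.len w) :
    i ∈ M.descents w := by
  have := M.len_mul_simple w i
  rw [mem_descents]
  omega

theorem mem_descents_of_le {w : M.Group} {i : I} (h : M.len (w * M.simple i) ≤ M.len w) :
    i ∈ M.descents w := by
  have := M.len_mul_simple w i
  rw [mem_descents]
  omega

theorem notMem_ascents_iff {w : M.Group} {i : I} : i ∉ M.ascents w ↔ i ∈ M.descents w := by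
  have := M.len_mul_simple w i
  rw [mem_descents, mem_ascents]
  omega

theorem notMem_descents_iff {w : M.Group} {i : I} : i ∉ M.descents w ↔ i ∈ M.ascents w := by
  rw [← notMem_ascents_iff, not_not]

theorem notMem_descents_one (i : I) : i ∉ M.descents 1 := by
  simp [mem_descents]

theorem mem_ascents_mul_simple {w : M.Group} {i : I} :
    i ∈ M.ascents (w * M.simple i) ↔ i ∈ M.descents w := by
  rw [mem_descents, mem_ascents, mul_simple_mul_self]
  exact eq_comm

/-- If `ω` is reduced and `i` is an ascent of the element it represents, then `ω i` is reduced. -/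
theorem len_word_concat {ω : List I} (hω : M.len (M.word ω) = ω.length) {i : I}
    (hi : i ∈ M.ascents (M.word ω)) : M.len (M.word (ω ++ [i])) = (ω ++ [i]).length := by
  rw [mem_ascents] at hi
  simp [hi, hω]

theorem reduced_of_append {ω ω' : List I}
    (h : M.len (M.word (ω ++ ω')) = (ω ++ ω').length) :
    M.len (M.word ω) = ω.length ∧ M.len (M.word ω') = ω'.length := by
  have h1 := M.len_word_le ω
  have h2 := M.len_word_le ω'
  have h3 := M.len_mul_le (M.word ω) (M.word ω')
  rw [word_append, List.length_append] at h
  omega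

end Words

/-! ### The exchange condition -/

section Exchange

open CoxeterSystem

variable {I : Type*} (M : CoxeterMatrix I)

open Classical in
/-- The action of a standard generator on pairs `(t, e)`: conjugate `t`, and flip the sign `e` if
`t` is this generator. -/
noncomputable def signedConj (i : I) : Equiv.Perm (M.Group × ZMod 2) :=
  Function.Involutive.toPerm
    (fun x => (M.simple i * x.1 * M.simple i, x.2 + if x.1 = M.simple i then 1 else 0)) (by
      rintro ⟨t, e⟩
      have h : M.simple i * t * M.simple i = M.simple i ↔ t = M.simple i := by
        rw [mul_assoc, mul_eq_left, mul_eq_one_iff_eq_inv, simple_inv]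
      simp only [h, Prod.mk.injEq]
      refine ⟨by simp [mul_assoc], ?_⟩
      rw [add_assoc, CharTwo.add_self_eq_zero, add_zero])

open Classical in
theorem signedConj_apply (i : I) (x : M.Group × ZMod 2) :
    M.signedConj i x =
      (M.simple i * x.1 * M.simple i, x.2 + if x.1 = M.simple i then 1 else 0) := rfl

-- The reflections `(s_j s_i)^k s_j`, `k < 2n`, are the ones whose signs are flipped, one flip for
-- each occurrence.
open Classical in
theorem signedConj_mul_pow_apply (i j : I) (n : ℕ) (t : M.Group) (e : ZMod 2) :
    ((M.signedConj i * M.signedConj j) ^ n) (t, e) =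
      ((M.simple i * M.simple j) ^ n * t * (M.simple j * M.simple i) ^ n,
        e + ∑ k ∈ Finset.range (2 * n),
          if t = (M.simple j * M.simple i) ^ k * M.simple j then 1 else 0) := by
  induction n generalizing t e with
  | zero => simp
  | succ n ih =>
    have hu : M.simple i * M.simple j = (M.simple j * M.simple i)⁻¹ := by simp
    rw [pow_succ, Equiv.Perm.mul_apply, Equiv.Perm.mul_apply, signedConj_apply, signedConj_apply,
      ih, show 2 * (n + 1) = 2 * n + 1 + 1 by ring, Finset.sum_range_succ',
      Finset.sum_range_succ']
    ext1
    · simp only [pow_succ (M.simple i * M.simple j), pow_succ' (M.simple j * M.simple i), mul_assoc]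
    · have h1 : (M.simple j * t * M.simple j = M.simple i) ↔
          t = (M.simple j * M.simple i) ^ (0 + 1) * M.simple j := by
        rw [zero_add, pow_one]
        constructor
        · intro h
          rw [← h]
          simp [mul_assoc]
        · rintro rfl
          simp [mul_assoc]
      have h2 : ∀ k : ℕ, (M.simple i * (M.simple j * t * M.simple j) * M.simple i =
          (M.simple j * M.simple i) ^ k * M.simple j) ↔
          t = (M.simple j * M.simple i) ^ (k + 1 + 1) * M.simple j := by
        intro k
        have h3 : M.simple j * (M.simple i * M.simple j) =
            (M.simple j * M.simple i) * M.simple j := by rw [mul_assoc]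
        rw [show M.simple i * (M.simple j * t * M.simple j) * M.simple i =
          (M.simple j * M.simple i)⁻¹ * t * (M.simple j * M.simple i) by simp [mul_assoc],
          ← eq_mul_inv_iff_mul_eq, inv_mul_eq_iff_eq_mul, ← hu, mul_assoc _ (M.simple j), h3,
          pow_succ (M.simple j * M.simple i) (k + 1), pow_succ' (M.simple j * M.simple i) k]
        simp only [mul_assoc]
      simp only [h1, h2, pow_zero, one_mul]
      ring

/-- Since `(s_j s_i)^m = 1`, the list of `2m` reflections runs twice through the same `m` terms, so
each sign is flipped an even number of times. -/
theorem signedConj_isLiftable : M.IsLiftable M.signedConj := by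
  classical
  intro i j
  ext1 ⟨t, e⟩
  have hp : (M.simple i * M.simple j) ^ M i j = 1 := M.toCoxeterSystem.simple_mul_simple_pow i j
  have hp' : (M.simple j * M.simple i) ^ M i j = 1 := M.toCoxeterSystem.simple_mul_simple_pow' i j
  rw [signedConj_mul_pow_apply, hp, hp', two_mul, Finset.sum_range_add]
  simp only [pow_add, hp', one_mul, mul_one, CharTwo.add_self_eq_zero, add_zero]
  rfl

/-- The signed conjugation action of the Coxeter group. -/
noncomputable def signedConjHom : M.Group →* Equiv.Perm (M.Group × ZMod 2) :=
  M.toCoxeterSystem.lift ⟨M.signedConj, M.signedConj_isLiftable⟩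

theorem signedConjHom_simple (i : I) : M.signedConjHom (M.simple i) = M.signedConj i :=
  M.toCoxeterSystem.lift_apply_simple M.signedConj_isLiftable i

-- As the left side depends only on the group element, so does the parity of the number of
-- occurrences of `t` in the right inversion sequence of a word.
open Classical in
theorem signedConjHom_word (ω : List I) (t : M.Group) (e : ZMod 2) :
    M.signedConjHom (M.word ω) (t, e) =
      (M.word ω * t * (M.word ω)⁻¹, e + (M.toCoxeterSystem.rightInvSeq ω).count t) := by
  induction ω with
  | nil => simp
  | cons i ω ih =>
    rw [word_cons, map_mul, Equiv.Perm.mul_apply, ih, signedConjHom_simple, signedConj_apply,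
      rightInvSeq, List.count_cons]
    ext1
    · simp [mul_assoc]
    · have : (M.word ω * t * (M.word ω)⁻¹ = M.simple i) ↔
          (M.toCoxeterSystem.wordProd ω)⁻¹ * M.toCoxeterSystem.simple i *
            M.toCoxeterSystem.wordProd ω = t := by
        rw [← word_eq_wordProd, toCoxeterSystem_simple, mul_inv_eq_iff_eq_mul, mul_assoc,
          inv_mul_eq_iff_eq_mul]
        exact eq_comm
      simp only [this, beq_iff_eq]
      push_cast
      ring

/-- The exchange condition. -/
theorem exchange {ω : List I} {i : I}
    (hi : i ∈ M.descents (M.word ω)) :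
    ∃ l₁ j l₂, ω = l₁ ++ j :: l₂ ∧ M.word ω * M.simple i = M.word (l₁ ++ l₂) := by
  classical
  -- Compare `ω` with a reduced word of the same element that ends in `i`. There `s_i` occurs
  -- exactly once in the inversion sequence, so by parity it occurs in that of `ω`.
  have hmem : M.simple i ∈ M.toCoxeterSystem.rightInvSeq ω := by
    obtain ⟨ω', h1, h2⟩ := M.exists_word (M.word ω * M.simple i)
    have h3 : M.word (ω' ++ [i]) = M.word ω := by simp [h1]
    have h4 : M.toCoxeterSystem.IsReduced (ω'.concat i) := by
      rw [List.concat_eq_append]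
      refine M.len_word_concat h2 ?_
      rw [h1, mem_ascents_mul_simple]
      exact hi
    have h5 : M.simple i ∈ M.toCoxeterSystem.rightInvSeq (ω'.concat i) := by
      rw [M.toCoxeterSystem.rightInvSeq_concat]
      simp
    have h6 := M.signedConjHom_word (ω'.concat i) (M.simple i) 0
    rw [List.concat_eq_append, h3, M.signedConjHom_word, ← List.concat_eq_append,
      List.count_eq_one_of_mem h4.nodup_rightInvSeq h5, zero_add, zero_add] at h6
    by_contra hmem
    rw [List.count_eq_zero_of_not_mem hmem] at h6
    simpa using congrArg Prod.snd h6
  obtain ⟨k, hk, hk'⟩ := List.mem_iff_getElem.mp hmem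
  have h7 := M.toCoxeterSystem.wordProd_mul_getD_rightInvSeq ω k
  rw [List.getD_eq_getElem _ _ hk, hk'] at h7
  rw [length_rightInvSeq] at hk
  refine ⟨ω.take k, ω[k], ω.drop (k + 1), by simp, ?_⟩
  rw [← List.eraseIdx_eq_take_drop_succ]
  exact h7

end Exchange

end CoxeterMatrix

namespace CoxeterMatrix

/-! ### Standard parabolic subgroups -/

section Parabolic

variable {I : Type*} (M : CoxeterMatrix I) {J : Set I}

theorem simple_mem_parabolic {j : I} (hj : j ∈ J) : M.simple j ∈ M.parabolic J :=
  Subgroup.subset_closure ⟨j, hj, rfl⟩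

theorem word_mem_parabolic {ω : List I} (h : ∀ j ∈ ω, j ∈ J) : M.word ω ∈ M.parabolic J := by
  induction ω with
  | nil => exact one_mem _
  | cons i ω ih =>
    rw [word_cons]
    exact mul_mem (M.simple_mem_parabolic (h i (by simp)))
      (ih fun j hj => h j (List.mem_cons_of_mem _ hj))

theorem parabolic_mono {K : Set I} (h : J ⊆ K) : M.parabolic J ≤ M.parabolic K :=
  Subgroup.closure_mono (Set.image_mono h)

theorem exists_word_of_mem_parabolic {w : M.Group} (hw : w ∈ M.parabolic J) :
    ∃ ω : List I, (∀ j ∈ ω, j ∈ J) ∧ M.word ω = w := by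
  induction hw using Subgroup.closure_induction with
  | mem x hx =>
    obtain ⟨j, hj, rfl⟩ := hx
    exact ⟨[j], by simpa using hj, by simp⟩
  | one => exact ⟨[], by simp, rfl⟩
  | mul x y _ _ hx hy =>
    obtain ⟨ω, h1, rfl⟩ := hx
    obtain ⟨ω', h2, rfl⟩ := hy
    exact ⟨ω ++ ω', by simpa [or_imp, forall_and] using ⟨h1, h2⟩, by simp⟩
  | inv x _ hx =>
    obtain ⟨ω, h1, rfl⟩ := hx
    exact ⟨ω.reverse, by simpa using h1, M.word_reverse ω⟩

/-- An element represented by a word has a reduced expression with letters in this word. -/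
theorem exists_reduced_word_of_word (ω : List I) :
    ∃ ω' : List I, (∀ j ∈ ω', j ∈ ω) ∧ M.word ω' = M.word ω ∧
      M.len (M.word ω') = ω'.length := by
  induction ω using List.reverseRecOn with
  | nil => exact ⟨[], by simp, rfl, by simp⟩
  | append_singleton ω i ih =>
    obtain ⟨ω', h1, h2, h3⟩ := ih
    by_cases hi : i ∈ M.ascents (M.word ω')
    · refine ⟨ω' ++ [i], ?_, by simp [h2], M.len_word_concat h3 hi⟩
      simp only [List.mem_append, List.mem_singleton]
      rintro j (hj | rfl)
      · exact .inl (h1 j hj)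
      · exact .inr rfl
    · rw [notMem_ascents_iff] at hi
      obtain ⟨l₁, k, l₂, rfl, h5⟩ := M.exchange hi
      refine ⟨l₁ ++ l₂, ?_, by rw [← h5, h2]; simp, ?_⟩
      · intro j hj
        refine List.mem_append_left _ (h1 j ?_)
        rw [List.mem_append] at hj ⊢
        exact hj.imp_right (List.mem_cons_of_mem _)
      · rw [mem_descents, h3, h5] at hi
        simp only [List.length_append, List.length_cons] at hi ⊢
        omega

theorem exists_reduced_word_of_mem_parabolic {w : M.Group} (hw : w ∈ M.parabolic J) :
    ∃ ω : List I, (∀ j ∈ ω, j ∈ J) ∧ M.word ω = w ∧ M.len (M.word ω) = ω.length := by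
  obtain ⟨ω, h1, rfl⟩ := M.exists_word_of_mem_parabolic hw
  obtain ⟨ω', h2, h3⟩ := M.exists_reduced_word_of_word ω
  exact ⟨ω', fun j hj => h1 j (h2 j hj), h3⟩

/-- Every non-trivial element of `W_J` has a descent in `J`. -/
theorem exists_descent_of_mem_parabolic {w : M.Group} (hw : w ∈ M.parabolic J) (h : w ≠ 1) :
    ∃ j ∈ J, j ∈ M.descents w := by
  obtain ⟨ω, h1, rfl, h3⟩ := M.exists_reduced_word_of_mem_parabolic hw
  rcases List.eq_nil_or_concat ω with rfl | ⟨ω', i, rfl⟩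
  · exact absurd rfl h
  · refine ⟨i, h1 i (by simp), M.mem_descents_of_lt ?_⟩
    have := M.len_word_le ω'
    rw [h3]
    simp
    omega

theorem exists_descent {w : M.Group} (h : w ≠ 1) : ∃ i, i ∈ M.descents w := by
  obtain ⟨ω, rfl, -⟩ := M.exists_word w
  obtain ⟨i, -, hi⟩ := M.exists_descent_of_mem_parabolic (J := Set.univ)
    (M.word_mem_parabolic fun _ _ => trivial) h
  exact ⟨i, hi⟩

/-- If `v` has minimal length in its coset `v W_J`, then lengths add in `v W_J`. -/
theorem len_mul_of_minimal {v : M.Group} (hv : ∀ z ∈ M.parabolic J, M.len v ≤ M.len (v * z))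
    {z : M.Group} (hz : z ∈ M.parabolic J) : M.len (v * z) = M.len v + M.len z := by
  obtain ⟨ω, h1, rfl, h3⟩ := M.exists_reduced_word_of_mem_parabolic hz
  clear hz
  induction ω using List.reverseRecOn with
  | nil => simp
  | append_singleton ω i ih =>
    have h4 := (M.reduced_of_append h3).1
    have h1' : ∀ j ∈ ω, j ∈ J := fun j hj => h1 j (List.mem_append_left _ hj)
    specialize ih h1' h4
    obtain ⟨ν, hν, hν'⟩ := M.exists_word v
    by_contra hne
    have hi : i ∈ M.descents (M.word (ν ++ ω)) := by
      rw [← notMem_ascents_iff]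
      intro hi
      rw [mem_ascents, word_append, hν, ih] at hi
      apply hne
      rw [h3, word_append, ← mul_assoc, word_cons, word_nil, mul_one, hi, h4]
      simp [add_assoc]
    have hlt := hi
    rw [mem_descents] at hlt
    obtain ⟨l₁, k, l₂, h5, h6⟩ := M.exchange hi
    have h3' : M.len (M.word ω * M.simple i) = ω.length + 1 := by simpa using h3
    rw [word_append, hν] at h6
    -- The exchange condition deletes a letter of `ν ω`. In `ω` the deletion would shorten the
    -- reduced word `ω i`.
    have main : ∀ a : List I, l₁ = ν ++ a → ω = a ++ k :: l₂ → False := by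
      rintro a rfl rfl
      rw [List.append_assoc, word_append _ ν, hν, mul_assoc, mul_right_inj] at h6
      have h8 := M.len_word_le (a ++ l₂)
      rw [← h6, h3'] at h8
      simp only [List.length_append, List.length_cons] at h8
      omega
    rcases List.append_eq_append_iff.mp h5 with ⟨a, h7, h8⟩ | ⟨a, h7, h8⟩
    · exact main a h7 h8
    · cases a with
      | nil => exact main [] (by simpa using h7.symm) (by simpa using h8.symm)
      | cons k' a =>
        simp only [List.cons_append, List.cons.injEq] at h8
        obtain ⟨rfl, rfl⟩ := h8
        rw [← List.append_assoc, word_append] at h6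
        -- Deleting a letter of `ν` multiplies `v` by a conjugate of `s_i` lying in `W_J`, and
        -- contradicts the minimality of `v`.
        have h9 : M.word (l₁ ++ a) = v * (M.word ω * M.simple i * (M.word ω)⁻¹) := by
          rw [← mul_assoc, ← mul_assoc, h6, mul_inv_cancel_right]
        have h10 := hv (M.word ω * M.simple i * (M.word ω)⁻¹) <|
          mul_mem (mul_mem (M.word_mem_parabolic h1') (M.simple_mem_parabolic (h1 i (by simp))))
            (inv_mem (M.word_mem_parabolic h1'))
        rw [← h9] at h10
        have h11 := M.len_word_le (l₁ ++ a)
        rw [← hν, hν', h7] at h10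
        simp at h10 h11
        omega

theorem exists_minimal_decomposition (J : Set I) (w : M.Group) :
    ∃ v z, w = v * z ∧ z ∈ M.parabolic J ∧ ∀ y ∈ M.parabolic J, M.len v ≤ M.len (v * y) := by
  obtain ⟨z, hz, hmin⟩ := (measure fun z => M.len (w * z)).wf.has_min
    (M.parabolic J : Set M.Group) ⟨1, one_mem _⟩
  refine ⟨w * z, z⁻¹, by simp, inv_mem hz, fun y hy => ?_⟩
  rw [mul_assoc]
  exact not_lt.mp (hmin (z * y) (mul_mem hz hy))

/-- If all the elements of `J` are ascents of `v`, then lengths add in `v W_J`. -/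
theorem len_mul_of_subset_ascents {v : M.Group} (hv : J ⊆ M.ascents v) {z : M.Group}
    (hz : z ∈ M.parabolic J) : M.len (v * z) = M.len v + M.len z := by
  obtain ⟨v₀, y, rfl, hy, hmin⟩ := M.exists_minimal_decomposition J v
  -- In fact `v` is itself minimal in its coset: otherwise a descent of `y` in `J` would be a
  -- descent of `v`.
  by_cases h : y = 1
  · subst h
    rw [mul_one]
    exact M.len_mul_of_minimal hmin hz
  · obtain ⟨j, hj, hjd⟩ := M.exists_descent_of_mem_parabolic hy h
    have h1 := M.len_mul_of_minimal hmin hy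
    have h2 := M.len_mul_of_minimal hmin (mul_mem hy (M.simple_mem_parabolic hj))
    have h3 := hv hj
    rw [mem_ascents, mul_assoc] at h3
    rw [mem_descents] at hjd
    omega

/-- Every `w` is a product `v z` with `J ⊆ I⁺(v)` and `z ∈ W_J`. -/
theorem exists_decomposition (J : Set I) (w : M.Group) :
    ∃ v z, w = v * z ∧ z ∈ M.parabolic J ∧ J ⊆ M.ascents v := by
  obtain ⟨v, z, h1, h2, h3⟩ := M.exists_minimal_decomposition J w
  refine ⟨v, z, h1, h2, fun j hj => ?_⟩
  simpa [mem_ascents] using M.len_mul_of_minimal h3 (M.simple_mem_parabolic hj)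

/-- The left-hand version of `len_mul_of_subset_ascents`. -/
theorem len_mul_of_subset_ascents_inv {v : M.Group} (hv : J ⊆ M.ascents v⁻¹) {z : M.Group}
    (hz : z ∈ M.parabolic J) : M.len (z * v) = M.len z + M.len v := by
  have := M.len_mul_of_subset_ascents hv (inv_mem hz)
  rwa [← mul_inv_rev, len_inv, len_inv, len_inv, add_comm] at this

/-- For `v` with `J ⊆ I⁺(v)` and `z ∈ W_J`, the descents of `v z` in `J` are those of `z`. -/
theorem mem_descents_mul_iff {v : M.Group} (hv : J ⊆ M.ascents v) {z : M.Group}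
    (hz : z ∈ M.parabolic J) {j : I} (hj : j ∈ J) :
    j ∈ M.descents (v * z) ↔ j ∈ M.descents z := by
  have h1 := M.len_mul_of_subset_ascents hv hz
  have h2 := M.len_mul_of_subset_ascents hv (mul_mem hz (M.simple_mem_parabolic hj))
  rw [mem_descents, mem_descents, mul_assoc]
  omega

/-- If all the elements of `J` are descents of `z`, then every element of `W_J` is a suffix
of `z`. -/
theorem len_mul_inv_of_subset_descents {z : M.Group} (hz : J ⊆ M.descents z) {y : M.Group}
    (hy : y ∈ M.parabolic J) : M.len (z * y⁻¹) + M.len y = M.len z := by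
  obtain ⟨v, x, rfl, hx, hv⟩ := M.exists_decomposition J z
  have hxd : J ⊆ M.descents x := fun j hj => (M.mem_descents_mul_iff hv hx hj).mp (hz hj)
  rw [mul_assoc, M.len_mul_of_subset_ascents hv hx,
    M.len_mul_of_subset_ascents hv (mul_mem hx (inv_mem hy))]
  suffices M.len (x * y⁻¹) + M.len y = M.len x by omega
  obtain ⟨ω, h1, rfl, h3⟩ := M.exists_reduced_word_of_mem_parabolic hy
  clear hy
  induction ω using List.reverseRecOn with
  | nil => simp
  | append_singleton ω i ih =>
    have h4 := (M.reduced_of_append h3).1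
    have h1' : ∀ j ∈ ω, j ∈ J := fun j hj => h1 j (List.mem_append_left _ hj)
    specialize ih h1' h4
    obtain ⟨ν, hν, hν'⟩ := M.exists_word (x * (M.word ω)⁻¹)
    have hx' : M.word (ν ++ ω) = x := by simp [hν]
    have hi : i ∈ M.descents (M.word (ν ++ ω)) := by
      rw [hx']
      exact hxd (h1 i (by simp))
    have h3' : M.len (M.word ω * M.simple i) = ω.length + 1 := by simpa using h3
    obtain ⟨l₁, k, l₂, h5, h6⟩ := M.exchange hi
    -- As `ω i` is reduced, the letter deleted by the exchange condition lies in `ν`. What remains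
    -- of `ν` represents `x (ω i)⁻¹`, with one letter less than `x ω⁻¹`.
    have main : ∀ a : List I, l₁ = ν ++ a → ω = a ++ k :: l₂ → False := by
      rintro a rfl rfl
      rw [List.append_assoc, word_append, word_append _ ν, mul_assoc, mul_right_inj] at h6
      have h8 := M.len_word_le (a ++ l₂)
      rw [← h6, h3'] at h8
      simp only [List.length_append, List.length_cons] at h8
      omega
    rcases List.append_eq_append_iff.mp h5 with ⟨a, h7, h8⟩ | ⟨a, h7, h8⟩
    · exact (main a h7 h8).elim
    · cases a with
      | nil => exact (main [] (by simpa using h7.symm) (by simpa using h8.symm)).elim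
      | cons k' a =>
        simp only [List.cons_append, List.cons.injEq] at h8
        obtain ⟨rfl, rfl⟩ := h8
        rw [hx', ← List.append_assoc, word_append] at h6
        have h9 : M.word (l₁ ++ a) = x * (M.word (ω ++ [i]))⁻¹ := by
          simp only [word_append _ ω, word_cons, word_nil, mul_one, mul_inv_rev, simple_inv]
          rw [← mul_assoc, h6, mul_inv_cancel_right]
        have h10 := M.len_word_le (l₁ ++ a)
        have h11 := M.len_mul_le (x * (M.word (ω ++ [i]))⁻¹) (M.word (ω ++ [i]))
        rw [inv_mul_cancel_right] at h11
        rw [h9] at h10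
        rw [← hν, hν', h7] at ih
        simp at ih h10 h11 h3
        simp [h3]
        simp [h3] at h11
        omega

theorem len_le_of_subset_descents {z : M.Group} (hz : J ⊆ M.descents z) {y : M.Group}
    (hy : y ∈ M.parabolic J) : M.len y ≤ M.len z := by
  have := M.len_mul_inv_of_subset_descents hz hy
  omega

/-! ### Longest elements -/

/-- The index set may be infinite, but each descent `i` puts `s_i` in the right inversion sequence
of a fixed word for `z`, and distinct indices give distinct generators. -/
theorem finite_descents (z : M.Group) : (M.descents z).Finite := by
  obtain ⟨ω, rfl, -⟩ := M.exists_word z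
  refine Set.Finite.of_injOn (f := M.simple)
    (t := {t | t ∈ M.toCoxeterSystem.rightInvSeq ω}) ?_ M.simple_injective.injOn
    (List.finite_toSet _)
  intro i hi
  obtain ⟨l₁, j, l₂, h1, h2⟩ := M.exchange hi
  have h3 := M.toCoxeterSystem.wordProd_mul_getD_rightInvSeq ω l₁.length
  have hlt : l₁.length < (M.toCoxeterSystem.rightInvSeq ω).length := by
    rw [CoxeterSystem.length_rightInvSeq, h1]
    simp
  have h4 : ω.eraseIdx l₁.length = l₁ ++ l₂ := by
    rw [h1, List.eraseIdx_append_of_length_le le_rfl]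
    simp
  rw [h4, ← word_eq_wordProd, ← word_eq_wordProd, ← h2, mul_right_inj,
    List.getD_eq_getElem _ _ hlt] at h3
  rw [Set.mem_ofPred_eq, ← h3]
  exact List.getElem_mem hlt

/-- `J` is finite and lengths in `W_J` are bounded by that of `z`, so finitely many words suffice.
This is how unions of blocks are shown to be spherical; `z` need not lie in `W_J`. -/
theorem isSpherical_of_subset_descents {z : M.Group} (hz : J ⊆ M.descents z) :
    M.IsSpherical J := by
  have hJ : J.Finite := (M.finite_descents z).subset hz
  have : Finite J := hJ
  have hfin : (M.parabolic J : Set M.Group).Finite := by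
    refine ((List.finite_length_le J (M.len z)).image
      fun l => M.word (l.map Subtype.val)).subset ?_
    intro y hy
    obtain ⟨ω, h1, h2, h3⟩ := M.exists_reduced_word_of_mem_parabolic hy
    have h4 := M.len_le_of_subset_descents hz hy
    refine ⟨ω.attach.map fun j => ⟨j.1, h1 j.1 j.2⟩, ?_, ?_⟩
    · simp only [Set.mem_ofPred_eq, List.length_map, List.length_attach]
      rw [← h3, h2]
      exact h4
    · simp [List.map_map, Function.comp_def, h2]
  exact hfin

theorem longest_mem (hJ : M.IsSpherical J) : M.longest J ∈ M.parabolic J :=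
  (M.longest_spec hJ).1

theorem len_le_longest (hJ : M.IsSpherical J) {v : M.Group} (hv : v ∈ M.parabolic J) :
    M.len v ≤ M.len (M.longest J) :=
  (M.longest_spec hJ).2 v hv

theorem subset_descents_longest (hJ : M.IsSpherical J) : J ⊆ M.descents (M.longest J) :=
  fun _ hj => M.mem_descents_of_le
    (M.len_le_longest hJ (mul_mem (M.longest_mem hJ) (M.simple_mem_parabolic hj)))

/-- The longest element of `W_J` is the only element of `W_J` whose descents contain `J`. -/
theorem eq_longest_of_subset_descents {z : M.Group} (hz : z ∈ M.parabolic J)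
    (hzd : J ⊆ M.descents z) : z = M.longest J := by
  have hJ := M.isSpherical_of_subset_descents hzd
  have h1 := M.len_mul_inv_of_subset_descents hzd (M.longest_mem hJ)
  have h2 := M.len_le_longest hJ hz
  have h3 : M.len (z * (M.longest J)⁻¹) = 0 := by omega
  rwa [len_eq_zero, mul_inv_eq_one] at h3

theorem longest_inv (hJ : M.IsSpherical J) : (M.longest J)⁻¹ = M.longest J := by
  refine M.eq_longest_of_subset_descents (inv_mem (M.longest_mem hJ)) fun j hj =>
    M.mem_descents_of_le ?_
  rw [len_inv]
  exact M.len_le_longest hJ (mul_mem (inv_mem (M.longest_mem hJ)) (M.simple_mem_parabolic hj))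

theorem longest_mul_self (hJ : M.IsSpherical J) : M.longest J * M.longest J = 1 := by
  nth_rw 1 [← M.longest_inv hJ]
  exact inv_mul_cancel _

theorem longest_ne_one (hJ : M.IsSpherical J) (hne : J.Nonempty) : M.longest J ≠ 1 := by
  obtain ⟨j, hj⟩ := hne
  intro h
  have := M.subset_descents_longest hJ hj
  rw [h] at this
  exact M.notMem_descents_one j this

theorem simple_eq_longest (j : I) : M.simple j = M.longest {j} :=
  M.eq_longest_of_subset_descents (M.simple_mem_parabolic rfl) <| by
    rintro _ rfl
    simp [mem_descents]

end Parabolic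

end CoxeterMatrix

namespace CoxeterMatrix

open CoxeterSystem (alternatingWord alternatingWord_succ alternatingWord_succ'
  length_alternatingWord)

/-! ### Dihedral parabolic subgroups -/

section Dihedral

variable {I : Type*} (M : CoxeterMatrix I)

/-- The quotient of the two alternating words of length `n` is, up to inversion and conjugation,
`(s_i s_j)^n`. The morphism `f` is there so that this applies to the identity and also to images in
another Coxeter group. -/
theorem map_mul_pow_eq_one_of_alternatingWord {G : Type*} [Group G] (f : M.Group →* G) (i j : I)
    (n : ℕ) (h : f (M.word (alternatingWord i j n)) = f (M.word (alternatingWord j i n))) :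
    f (M.simple i * M.simple j) ^ n = 1 := by
  have hij : M.simple j * M.simple i = (M.simple i * M.simple j)⁻¹ := by simp
  rw [word_eq_wordProd, word_eq_wordProd, CoxeterSystem.prod_alternatingWord_eq_mul_pow,
    CoxeterSystem.prod_alternatingWord_eq_mul_pow] at h
  simp only [toCoxeterSystem_simple] at h
  rw [hij] at h
  set x := M.simple i * M.simple j with hx
  rcases Nat.even_or_odd' n with ⟨k, rfl | rfl⟩
  · rw [if_pos (by simp), if_pos (by simp), one_mul, one_mul, Nat.mul_div_cancel_left k two_pos,
      inv_pow, map_inv, eq_inv_iff_mul_eq_one, ← map_mul, ← pow_add, ← two_mul, map_pow] at h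
    exact h
  · have hodd : ¬ Even (2 * k + 1) := by simp
    rw [if_neg hodd, if_neg hodd, show (2 * k + 1) / 2 = k by omega, map_mul, map_mul,
      inv_pow, map_inv, ← mul_inv_eq_iff_eq_mul, inv_inv, mul_assoc, ← map_mul, ← pow_add] at h
    have h2 : f (M.simple i) * (f (M.simple j) * f (x ^ (k + k))) = 1 := by
      rw [h, ← map_mul, simple_mul_self, map_one]
    rw [← mul_assoc, ← map_mul, ← hx, ← map_mul, ← pow_succ', ← two_mul, map_pow] at h2
    exact h2

/-- A reduced word has no two equal adjacent letters. A non-empty `alternatingWord i j n` ends in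
`j`, so the word stays alternating when `i` is appended. -/
theorem eq_alternatingWord_of_reduced {i j : I} {ω : List I} (h1 : ∀ k ∈ ω, k = i ∨ k = j)
    (h2 : M.len (M.word (ω ++ [i])) = (ω ++ [i]).length) :
    ω = alternatingWord i j ω.length := by
  induction ω using List.reverseRecOn generalizing i j with
  | nil => rfl
  | append_singleton ω k ih =>
    have hk : k ≠ i := by
      rintro rfl
      have := M.len_word_le ω
      simp at h2
      omega
    have hk' : k = j := (h1 k (by simp)).resolve_left hk
    subst hk'
    have h3 := ih (i := k) (j := i) (fun l hl => (h1 l (List.mem_append_left _ hl)).symm)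
      (M.reduced_of_append h2).1
    rw [List.length_append, List.length_singleton, alternatingWord_succ, ← h3,
      List.concat_eq_append]

/-- An element of a dihedral parabolic subgroup with `i` as an ascent is represented by an
alternating word which remains reduced after adding `i`. -/
theorem exists_alternatingWord {i j : I} {u : M.Group} (hu : u ∈ M.parabolic {i, j})
    (hi : i ∈ M.ascents u) :
    ∃ n, u = M.word (alternatingWord i j n) ∧ M.len u = n ∧ (M i j ≠ 0 → n + 1 ≤ M i j) := by
  obtain ⟨ω, h1, rfl, h3⟩ := M.exists_reduced_word_of_mem_parabolic hu
  have h4 := M.len_word_concat h3 hi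
  have h5 := M.eq_alternatingWord_of_reduced (j := j) h1 h4
  refine ⟨ω.length, by rw [← h5], h3, fun hm => ?_⟩
  by_contra hlt
  rw [not_le] at hlt
  rw [M.symmetric] at hm hlt
  -- An alternating word of more than `m` letters is not reduced, whereas the word with `i` appended
  -- is.
  refine M.toCoxeterSystem.not_isReduced_alternatingWord j i hm hlt ?_
  rw [alternatingWord_succ, ← h5, List.concat_eq_append]
  exact h4

/-- If two elements `i`, `j` are descents of an element of `W_{i,j}`, then this element
is represented by the two braid words. -/
theorem eq_word_alternatingWord_of_descents {i j : I} {z : M.Group}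
    (hz : z ∈ M.parabolic {i, j}) (hi : i ∈ M.descents z) (hj : j ∈ M.descents z) :
    M i j ≠ 0 ∧ z = M.word (alternatingWord i j (M i j)) ∧ M.len z = M i j := by
  have hi' := mul_mem hz (M.simple_mem_parabolic (J := {i, j}) (j := i) (by simp))
  have hj' := mul_mem hz (M.simple_mem_parabolic (J := {i, j}) (j := j) (by simp))
  rw [Set.pair_comm] at hj'
  -- Removing a last letter `i`, or a last letter `j`, shows that `z` is given by both alternating
  -- words of length `n + 1`. Hence `m` divides `n + 1`, and `n + 1 ≤ m`.
  obtain ⟨n, h1, h2, h3⟩ := M.exists_alternatingWord hi' (M.mem_ascents_mul_simple.mpr hi)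
  obtain ⟨n', h1', h2', h3'⟩ := M.exists_alternatingWord hj' (M.mem_ascents_mul_simple.mpr hj)
  rw [mem_descents] at hi hj
  obtain rfl : n = n' := by omega
  have e1 : z = M.word (alternatingWord j i (n + 1)) := by
    simp [alternatingWord_succ, ← h1]
  have e2 : z = M.word (alternatingWord i j (n + 1)) := by
    simp [alternatingWord_succ, ← h1']
  have h4 := M.map_mul_pow_eq_one_of_alternatingWord (MonoidHom.id _) i j (n + 1)
    (by rw [← e1, ← e2])
  have h5 : M i j ∣ n + 1 := by
    rw [← orderOf_simple_mul_simple]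
    exact orderOf_dvd_of_pow_eq_one h4
  have h6 : M i j ≠ 0 := fun h => by
    rw [h, zero_dvd_iff] at h5
    omega
  have h7 : n + 1 = M i j := le_antisymm (h3 h6) (Nat.le_of_dvd n.succ_pos h5)
  rw [← h7]
  exact ⟨n.succ_ne_zero, e2, by omega⟩

end Dihedral

/-! ### Matsumoto's theorem -/

section Matsumoto

variable {I : Type*} (M : CoxeterMatrix I)

/-- `altProd` fixes the first factor while `alternatingWord` fixes the last letter, so the parity of
`n` decides which of the two orders appears. -/
theorem prod_map_alternatingWord {N : Type*} [Monoid N] (g : I → N) (i j : I) (n : ℕ) :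
    ((alternatingWord i j n).map g).prod =
      if Even n then altProd n (g i) (g j) else altProd n (g j) (g i) := by
  induction n generalizing i j with
  | zero => rfl
  | succ n ih =>
    rw [alternatingWord_succ', List.map_cons, List.prod_cons, ih]
    by_cases h : Even n <;> simp [h, Nat.even_add_one, altProd, -Nat.not_even_iff_odd]

/-- Matsumoto's theorem: a map from the index set to a monoid that satisfies the braid relations
takes the same value on all the reduced words of an element. -/
theorem prod_map_eq_of_reduced {N : Type*} [Monoid N] (g : I → N)
    (hg : ∀ i j, M i j ≠ 0 → altProd (M i j) (g i) (g j) = altProd (M i j) (g j) (g i))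
    {ω ω' : List I} (hω : M.len (M.word ω) = ω.length) (hω' : M.len (M.word ω') = ω'.length)
    (h : M.word ω = M.word ω') : (ω.map g).prod = (ω'.map g).prod := by
  induction hn : ω.length using Nat.strong_induction_on generalizing ω ω' with
  | _ n ih =>
  subst hn
  have ih_concat : ∀ {τ τ' : List I} {i : I}, (τ ++ [i]).length = ω.length →
      M.len (M.word (τ ++ [i])) = (τ ++ [i]).length →
      M.len (M.word (τ' ++ [i])) = (τ' ++ [i]).length →
      M.word (τ ++ [i]) = M.word (τ' ++ [i]) →
      ((τ ++ [i]).map g).prod = ((τ' ++ [i]).map g).prod := by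
    intro τ τ' i h1 h2 h3 h4
    have h5 := ih τ.length (by simp at h1; omega) (M.reduced_of_append h2).1
      (M.reduced_of_append h3).1 (by simpa using h4) rfl
    simp [h5]
  have hlen : ω.length = ω'.length := by rw [← hω, ← hω', h]
  rcases List.eq_nil_or_concat ω with rfl | ⟨ω₁, i, rfl⟩
  · rw [List.length_nil] at hlen
    rw [List.eq_nil_of_length_eq_zero hlen.symm]
  rcases List.eq_nil_or_concat ω' with rfl | ⟨ω₁', j, rfl⟩
  · simp at hlen
  rw [List.concat_eq_append] at *
  rw [List.concat_eq_append] at *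
  rcases eq_or_ne i j with rfl | hij
  · exact ih_concat rfl hω hω' h
  have descent : ∀ {τ : List I} {k : I}, M.len (M.word (τ ++ [k])) = (τ ++ [k]).length →
      k ∈ M.descents (M.word (τ ++ [k])) := by
    intro τ k hτ
    have h1 := (M.reduced_of_append hτ).1
    rw [mem_descents, hτ]
    simp [h1]
  have hi := descent hω
  have hj := descent hω'
  rw [← h] at hj
  -- When the last letters differ, `i` and `j` are both descents, so the dihedral part `z` is given
  -- by both braid words. The two given words are linked through `ν` followed by one braid word or
  -- the other: each of these shares its last letter with one of the given words, and the braid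
  -- relation joins them.
  obtain ⟨v, z, hw, hz, hv⟩ := M.exists_decomposition {i, j} (M.word (ω₁ ++ [i]))
  have hwlen := M.len_mul_of_subset_ascents hv hz
  rw [hw, M.mem_descents_mul_iff hv hz (by simp)] at hi hj
  obtain ⟨hm, hz1, hzlen⟩ := M.eq_word_alternatingWord_of_descents hz hi hj
  obtain ⟨-, hz2, -⟩ := M.eq_word_alternatingWord_of_descents
    (by rwa [Set.pair_comm]) hj hi
  obtain ⟨ν, rfl, hν⟩ := M.exists_word v
  have hbraid : ((ν ++ alternatingWord j i (M i j)).map g).prod =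
      ((ν ++ alternatingWord i j (M i j)).map g).prod := by
    rw [List.map_append, List.map_append, List.prod_append, List.prod_append,
      prod_map_alternatingWord, prod_map_alternatingWord, hg i j hm]
  rw [← M.symmetric i j] at hz2
  have e1 : M.word (ν ++ alternatingWord j i (M i j)) = M.word (ω₁ ++ [i]) := by
    rw [hw, word_append, ← hz2]
  have e2 : M.word (ν ++ alternatingWord i j (M i j)) = M.word (ω₁ ++ [i]) := by
    rw [hw, word_append, ← hz1]
  have l1 : ∀ a b, M.word (ν ++ alternatingWord a b (M i j)) = M.word (ω₁ ++ [i]) →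
      M.len (M.word (ν ++ alternatingWord a b (M i j))) =
        (ν ++ alternatingWord a b (M i j)).length := by
    intro a b hab
    rw [hab, hw, hwlen, hzlen, hν, List.length_append, length_alternatingWord]
  have l2 := l1 j i e1
  have l3 := l1 i j e2
  obtain ⟨n, hn⟩ := Nat.exists_eq_succ_of_ne_zero hm
  rw [hn, Nat.succ_eq_add_one, alternatingWord_succ, alternatingWord_succ, List.concat_eq_append,
    List.concat_eq_append, ← List.append_assoc, ← List.append_assoc] at hbraid
  rw [hn, Nat.succ_eq_add_one, alternatingWord_succ, List.concat_eq_append,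
    ← List.append_assoc] at e1 e2 l2 l3
  rw [ih_concat rfl hω l2 e1.symm, hbraid]
  exact ih_concat (by rw [← l3, e2, hω]) l3 hω' (e2.trans h)

theorem artinGen_braid (i j : I) (h : M i j ≠ 0) :
    altProd (M i j) (M.artinGen i) (M.artinGen j) =
      altProd (M i j) (M.artinGen j) (M.artinGen i) := by
  have key : PresentedMonoid.mk M.ArtinRel
      (altProd (M i j) (FreeMonoid.of i) (FreeMonoid.of j)) =
      PresentedMonoid.mk M.ArtinRel (altProd (M i j) (FreeMonoid.of j) (FreeMonoid.of i)) :=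
    Quotient.sound (ConGen.Rel.of _ _ (ArtinRel.braid i j h))
  rw [map_altProd, map_altProd] at key
  exact key

theorem simpleElt_word {ω : List I} (hω : M.len (M.word ω) = ω.length) :
    M.simpleElt (M.word ω) = (ω.map M.artinGen).prod := by
  have h := (M.toCoxeterSystem.exists_isReduced (M.word ω)).choose_spec
  exact M.prod_map_eq_of_reduced M.artinGen M.artinGen_braid h.1 hω h.2.symm

theorem simpleElt_one : M.simpleElt 1 = 1 := by
  simpa using M.simpleElt_word (ω := []) (by simp)

theorem simpleElt_mul {v w : M.Group} (h : M.len (v * w) = M.len v + M.len w) :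
    M.simpleElt (v * w) = M.simpleElt v * M.simpleElt w := by
  obtain ⟨ω, rfl, hω⟩ := M.exists_word v
  obtain ⟨ω', rfl, hω'⟩ := M.exists_word w
  rw [M.simpleElt_word hω, M.simpleElt_word hω', ← word_append, simpleElt_word]
  · simp
  · rw [word_append, h, hω, hω', List.length_append]

end Matsumoto

end CoxeterMatrix

namespace CoxeterMatrix

open CoxeterSystem (alternatingWord alternatingWord_succ alternatingWord_succ'
  length_alternatingWord)

/-! ### Coxeter groups inside Coxeter groups -/

section Admissible

/-- The exchange condition deletes a letter of a word for `r w`. It cannot lie in the part for `w`,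
because `w s_i` is longer than `w`; so it lies in the part for `r`, and `w s_i w⁻¹ ∈ W_β`. -/
theorem mul_simple_eq_mul_of_descent {I : Type*} (M : CoxeterMatrix I) {β : Set I}
    {r w : M.Group} {i : I} (hr : r ∈ M.parabolic β) (hi : i ∈ M.ascents w)
    (hi' : i ∈ M.descents (r * w)) : ∃ v ∈ M.parabolic β, w * M.simple i = v * w := by
  obtain ⟨τ, hτ, rfl⟩ := M.exists_word_of_mem_parabolic hr
  obtain ⟨ν, rfl, hν⟩ := M.exists_word w
  rw [← word_append] at hi'
  obtain ⟨l₁, k, l₂, h5, h6⟩ := M.exchange hi'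
  have main : ∀ a : List I, l₁ = τ ++ a → ν = a ++ k :: l₂ → False := by
    rintro a rfl rfl
    rw [List.append_assoc, word_append _ τ, word_append _ τ, mul_assoc, mul_right_inj] at h6
    have h8 := M.len_word_le (a ++ l₂)
    rw [mem_ascents, hν, h6] at hi
    simp only [List.length_append, List.length_cons] at h8 hi
    omega
  rcases List.append_eq_append_iff.mp h5 with ⟨a, h7, h8⟩ | ⟨a, h7, h8⟩
  · exact (main a h7 h8).elim
  · cases a with
    | nil => exact (main [] (by simpa using h7.symm) (by simpa using h8.symm)).elim
    | cons k' a =>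
      simp only [List.cons_append, List.cons.injEq] at h8
      obtain ⟨rfl, rfl⟩ := h8
      have hmem : M.word (l₁ ++ a) ∈ M.parabolic β := by
        refine M.word_mem_parabolic fun j hj => hτ j ?_
        rw [h7]
        rw [List.mem_append] at hj ⊢
        exact hj.imp_right (List.mem_cons_of_mem _)
      refine ⟨(M.word τ)⁻¹ * M.word (l₁ ++ a), mul_mem (inv_mem hr) hmem, ?_⟩
      rw [← List.append_assoc, word_append _ (l₁ ++ a), word_append, mul_assoc] at h6
      rw [mul_assoc, ← h6, inv_mul_cancel_left]

/-- The exchange property of the subgroup generated by the longest elements of the blocks of an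
admissible partition. -/
theorem longest_mul_eq_mul_longest {I : Type*} (M : CoxeterMatrix I) {α β : Set I}
    (hα : M.IsSpherical α) (hβ : M.IsSpherical β) (hne : α.Nonempty) {G : Subgroup M.Group}
    (hG : ∀ w ∈ G, β ⊆ M.ascents w ∨ β ⊆ M.descents w) (hαG : M.longest α ∈ G)
    (hβG : M.longest β ∈ G) {w : M.Group} (hw : w ∈ G) (h1 : α ⊆ M.ascents w)
    (h2 : α ⊆ M.descents (M.longest β * w)) :
    M.longest β * w = w * M.longest α := by
  set r := M.longest β with hr
  have hrmem : r ∈ M.parabolic β := M.longest_mem hβ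
  have hrr : r * r = 1 := M.longest_mul_self hβ
  -- Otherwise `r w` is shorter than `w` by the length of `r`. An `i ∈ α` lengthens `w` and shortens
  -- `r w`, so `w s_i` and `r w s_i` would differ in length by more than the length of `r`.
  have hwβ : β ⊆ M.ascents w⁻¹ := by
    refine (hG _ (inv_mem hw)).resolve_right fun h3 => ?_
    have h4 := M.len_mul_inv_of_subset_descents h3 hrmem
    rw [← mul_inv_rev, len_inv, len_inv] at h4
    obtain ⟨i, hi⟩ := hne
    have h5 := h1 hi
    have h6 := h2 hi
    rw [mem_ascents] at h5
    rw [mem_descents] at h6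
    have h7 := M.len_mul_le r (r * w * M.simple i)
    rw [← mul_assoc, ← mul_assoc, hrr, one_mul] at h7
    omega
  have hconj : M.parabolic α ≤ (M.parabolic β).comap (MulAut.conj w).toMonoidHom := by
    rw [parabolic, Subgroup.closure_le]
    rintro _ ⟨i, hi, rfl⟩
    obtain ⟨v, hv, hv'⟩ := M.mul_simple_eq_mul_of_descent hrmem (h1 hi) (h2 hi)
    simpa [hv'] using hv
  have hv : w * M.longest α * w⁻¹ ∈ M.parabolic β := by
    simpa using hconj (M.longest_mem hα)
  set v := w * M.longest α * w⁻¹ with hvdef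
  have hvw : w * M.longest α = v * w := by rw [hvdef, inv_mul_cancel_right]
  have hlen : ∀ z ∈ M.parabolic β, M.len (z * w) = M.len z + M.len w :=
    fun z hz => M.len_mul_of_subset_ascents_inv hwβ hz
  -- Here `v = w r_α w⁻¹ ∈ W_β`. If `r v ≠ 1`, it has a left descent in `β`, hence so has `r v w = r
  -- w r_α ∈ G`, and by the alternative all of `β` consists of left descents of it. Then `len (r v)
  -- = len v + len r`, and the maximality of `r` forces `v = 1`, so `r_α = 1`, which is absurd.
  suffices r * v = 1 by
    rw [hvw, ← mul_right_inj r, ← mul_assoc, ← mul_assoc, hrr, this]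
  by_contra hrv
  obtain ⟨j, hj, hjd⟩ := M.exists_descent_of_mem_parabolic (inv_mem (mul_mem hrmem hv))
    (inv_ne_one.mpr hrv)
  have hyG : r * v * w ∈ G := by
    rw [mul_assoc, ← hvw]
    exact mul_mem hβG (mul_mem hw hαG)
  have hyd : β ⊆ M.descents (r * v * w)⁻¹ := by
    refine (hG _ (inv_mem hyG)).resolve_left fun h3 => ?_
    refine M.notMem_ascents_iff.mpr (M.mem_descents_of_lt ?_) (h3 hj)
    rw [mem_descents] at hjd
    have e1 : ∀ z : M.Group, z⁻¹ * M.simple j = (M.simple j * z)⁻¹ := by simp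
    rw [e1, len_inv, len_inv] at hjd ⊢
    rw [← mul_assoc, hlen _ (mul_mem hrmem hv),
      hlen _ (mul_mem (M.simple_mem_parabolic hj) (mul_mem hrmem hv))]
    omega
  have h4 := M.len_mul_inv_of_subset_descents hyd hrmem
  rw [← mul_inv_rev, len_inv, len_inv, ← mul_assoc, ← mul_assoc, hrr, one_mul, hlen v hv,
    hlen _ (mul_mem hrmem hv)] at h4
  have h5 := M.len_le_longest hβ (mul_mem hrmem hv)
  rw [← hr] at h5
  have h6 : v = 1 := M.len_eq_zero.mp (by omega)
  rw [hvdef, mul_inv_eq_one, mul_eq_left] at h6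
  exact M.longest_ne_one hα hne h6

variable {I I' : Type*} {M' : CoxeterMatrix I'} {M : CoxeterMatrix I} {p : I' → Set I}

/-- The subsets `p a` of `I` are non-empty and spherical, every element of the subgroup generated
by the longest elements `r_{p a}` has either only ascents or only descents in each `p a`, and the
matrix of the orders of the products of two of these longest elements is `M'`. -/
structure IsAdmissibleIn (M' : CoxeterMatrix I') (M : CoxeterMatrix I) (p : I' → Set I) : Prop where
  nonempty : ∀ a, (p a).Nonempty
  spherical : ∀ a, M.IsSpherical (p a)
  ascents_or_descents : ∀ w ∈ Subgroup.closure (Set.range fun a => M.longest (p a)), ∀ a,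
    p a ⊆ M.ascents w ∨ p a ⊆ M.descents w
  type_eq : ∀ a b, M' a b = orderOf (M.longest (p a) * M.longest (p b))

namespace IsAdmissibleIn

theorem isLiftable (h : IsAdmissibleIn M' M p) : M'.IsLiftable fun a => M.longest (p a) := by
  intro a b
  rw [h.type_eq]
  exact pow_orderOf_eq_one _

/-- The morphism of Coxeter groups that sends `s_a` to the longest element `r_{p a}`. -/
noncomputable def hom (h : IsAdmissibleIn M' M p) : M'.Group →* M.Group :=
  M'.toCoxeterSystem.lift ⟨_, h.isLiftable⟩

@[simp] theorem hom_simple (h : IsAdmissibleIn M' M p) (a : I') :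
    h.hom (M'.simple a) = M.longest (p a) :=
  M'.toCoxeterSystem.lift_apply_simple h.isLiftable a

theorem range_hom (h : IsAdmissibleIn M' M p) :
    h.hom.range = Subgroup.closure (Set.range fun a => M.longest (p a)) := by
  have := M'.toCoxeterSystem.subgroup_closure_range_simple
  rw [MonoidHom.range_eq_map, ← this, MonoidHom.map_closure, ← Set.range_comp]
  congr 2
  ext a
  exact h.hom_simple a

theorem subset_ascents_or_subset_descents (h : IsAdmissibleIn M' M p) (w : M'.Group) (a : I') :
    p a ⊆ M.ascents (h.hom w) ∨ p a ⊆ M.descents (h.hom w) :=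
  h.ascents_or_descents _ (h.range_hom ▸ ⟨w, rfl⟩) a

theorem not_subset_descents (h : IsAdmissibleIn M' M p) {w : M.Group} {a : I'}
    (ha : p a ⊆ M.ascents w) : ¬ p a ⊆ M.descents w := fun hd => by
  obtain ⟨i, hi⟩ := h.nonempty a
  exact M.notMem_ascents_iff.mpr (hd hi) (ha hi)

theorem hom_simple_mul (h : IsAdmissibleIn M' M p) {w : M'.Group} {a c : I'}
    (h1 : p a ⊆ M.ascents (h.hom w)) (h2 : p a ⊆ M.descents (h.hom (M'.simple c * w))) :
    h.hom (M'.simple c * w) = h.hom (w * M'.simple a) := by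
  have hmem : ∀ b, M.longest (p b) ∈ h.hom.range := fun b => ⟨_, h.hom_simple b⟩
  rw [map_mul, hom_simple] at h2
  rw [map_mul, map_mul, hom_simple, hom_simple]
  refine M.longest_mul_eq_mul_longest (h.spherical a) (h.spherical c) (h.nonempty a)
    (fun v hv => ?_) (hmem a) (hmem c) ⟨w, rfl⟩ h1 h2
  rw [h.range_hom] at hv
  exact h.ascents_or_descents v hv c

/-- If prefixing a letter turned `p a` from ascents into descents, `hom_simple_mul` would move that
letter to the right end as `a`. The two alternating words would then have the same image, and
`m_{a,b}`, the order of `r_{p a} r_{p b}`, would divide their length, which is positive and less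
than `m_{a,b}`. -/
theorem subset_ascents_alternatingWord (h : IsAdmissibleIn M' M p) {a b : I'} {n : ℕ}
    (hn : M' a b ≠ 0 → n + 1 ≤ M' a b) :
    p a ⊆ M.ascents (h.hom (M'.word (alternatingWord a b n))) := by
  induction n with
  | zero =>
    intro i _
    rw [← notMem_descents_iff]
    simpa [alternatingWord] using M.notMem_descents_one i
  | succ n ih =>
    refine (h.subset_ascents_or_subset_descents _ a).resolve_right fun hd => ?_
    rw [alternatingWord_succ', word_cons] at hd
    have h1 := h.hom_simple_mul (ih fun h0 => (Nat.le_succ _).trans (hn h0)) hd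
    have h2 := M'.map_mul_pow_eq_one_of_alternatingWord h.hom a b (n + 1) (by
      rw [alternatingWord_succ', word_cons, h1, alternatingWord_succ b a, List.concat_eq_append,
        word_append]
      simp)
    rw [map_mul, hom_simple, hom_simple] at h2
    have h3 := orderOf_dvd_of_pow_eq_one h2
    rw [← h.type_eq] at h3
    by_cases h0 : M' a b = 0
    · rw [h0, zero_dvd_iff] at h3
      omega
    · have := Nat.le_of_dvd n.succ_pos h3
      have := hn h0
      omega

theorem hom_mem_parabolic (h : IsAdmissibleIn M' M p) {w : M'.Group} {J : Set I'}
    (hw : w ∈ M'.parabolic J) : h.hom w ∈ M.parabolic (⋃ a ∈ J, p a) := by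
  suffices M'.parabolic J ≤ (M.parabolic (⋃ a ∈ J, p a)).comap h.hom from this hw
  rw [parabolic, Subgroup.closure_le]
  rintro _ ⟨a, ha, rfl⟩
  rw [SetLike.mem_coe, Subgroup.mem_comap, hom_simple]
  exact M.parabolic_mono (Set.subset_biUnion_of_mem ha) (M.longest_mem (h.spherical a))

/-- Induction on the length, through the dihedral subgroup of `a` and a descent `b` of `w`. The
coset representative `v` is strictly shorter than `w`, so `p a ∪ p b` consists of ascents of its
image, and the descents there are governed by the dihedral part alone. -/
theorem subset_ascents_hom_of_mem (h : IsAdmissibleIn M' M p) {w : M'.Group} {a : I'}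
    (ha : a ∈ M'.ascents w) : p a ⊆ M.ascents (h.hom w) := by
  induction hn : M'.len w using Nat.strong_induction_on generalizing w a with
  | _ n ih =>
  subst hn
  by_cases hw : w = 1
  · subst hw
    intro i _
    rw [← notMem_descents_iff, map_one]
    exact M.notMem_descents_one i
  obtain ⟨b, hb⟩ := M'.exists_descent hw
  obtain ⟨v, u, rfl, hu, hv⟩ := M'.exists_decomposition {a, b} w
  have hlen := M'.len_mul_of_subset_ascents hv hu
  have hau : a ∈ M'.ascents u := by
    rw [← notMem_descents_iff] at ha ⊢
    rwa [M'.mem_descents_mul_iff hv hu (by simp)] at ha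
  rw [M'.mem_descents_mul_iff hv hu (by simp)] at hb
  have hvlt : M'.len v < M'.len (v * u) := by
    rw [mem_descents] at hb
    omega
  have hva := ih _ hvlt (hv (by simp : a ∈ ({a, b} : Set I'))) rfl
  have hvb := ih _ hvlt (hv (by simp : b ∈ ({a, b} : Set I'))) rfl
  have hvab : (⋃ c ∈ ({a, b} : Set I'), p c) ⊆ M.ascents (h.hom v) := by
    simpa using ⟨hva, hvb⟩
  obtain ⟨n, rfl, -, hn⟩ := M'.exists_alternatingWord hu hau
  have hasc := h.subset_ascents_alternatingWord hn
  intro i hi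
  have hi' : i ∈ ⋃ c ∈ ({a, b} : Set I'), p c := by simp [hi]
  rw [← notMem_descents_iff, map_mul,
    M.mem_descents_mul_iff hvab (h.hom_mem_parabolic hu) hi', notMem_descents_iff]
  exact hasc hi

/-- As `a` is an ascent of `w s_a`, multiplication by `r_{p a}` lengthens the image of `w s_a`. It
cannot also lengthen the image of `w`, because `r_{p a}` is an involution of positive length. -/
theorem subset_descents_hom_of_mem (h : IsAdmissibleIn M' M p) {w : M'.Group} {a : I'}
    (ha : a ∈ M'.descents w) : p a ⊆ M.descents (h.hom w) := by
  refine (h.subset_ascents_or_subset_descents w a).resolve_left fun hasc => ?_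
  have h1 := h.subset_ascents_hom_of_mem (M'.mem_ascents_mul_simple.mpr ha)
  have h2 := M.len_mul_of_subset_ascents hasc (M.longest_mem (h.spherical a))
  have h3 := M.len_mul_of_subset_ascents h1 (M.longest_mem (h.spherical a))
  rw [map_mul, hom_simple, mul_assoc, M.longest_mul_self (h.spherical a), mul_one] at h3
  have h4 : M.len (M.longest (p a)) = 0 := by omega
  exact M.longest_ne_one (h.spherical a) (h.nonempty a) (M.len_eq_zero.mp h4)

theorem len_hom_mul_simple (h : IsAdmissibleIn M' M p) {w : M'.Group} {a : I'}
    (ha : a ∈ M'.ascents w) :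
    M.len (h.hom w * M.longest (p a)) = M.len (h.hom w) + M.len (M.longest (p a)) :=
  M.len_mul_of_subset_ascents (h.subset_ascents_hom_of_mem ha) (M.longest_mem (h.spherical a))

/-- A non-trivial element has a descent `a`, so its image has descents in the non-empty set `p a`
and is not trivial. -/
theorem hom_injective (h : IsAdmissibleIn M' M p) : Function.Injective h.hom := by
  rw [injective_iff_map_eq_one]
  intro w hw
  by_contra hne
  obtain ⟨a, ha⟩ := M'.exists_descent hne
  obtain ⟨i, hi⟩ := h.nonempty a
  have := h.subset_descents_hom_of_mem ha hi
  rw [hw] at this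
  exact M.notMem_descents_one i this

theorem mem_ascents_of_subset (h : IsAdmissibleIn M' M p) {w : M'.Group} {a : I'}
    (ha : p a ⊆ M.ascents (h.hom w)) : a ∈ M'.ascents w := by
  rw [← notMem_descents_iff]
  exact fun hd => h.not_subset_descents ha (h.subset_descents_hom_of_mem hd)

/-- The longest element of the parabolic subgroup attached to a union of blocks. -/
theorem hom_longest (h : IsAdmissibleIn M' M p) {J : Set I'} (hJ : M'.IsSpherical J) :
    h.hom (M'.longest J) = M.longest (⋃ a ∈ J, p a) :=
  M.eq_longest_of_subset_descents (h.hom_mem_parabolic (M'.longest_mem hJ)) <|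
    Set.iUnion₂_subset fun _ ha =>
      h.subset_descents_hom_of_mem (M'.subset_descents_longest hJ ha)

theorem isSpherical_biUnion (h : IsAdmissibleIn M' M p) {J : Set I'} (hJ : M'.IsSpherical J) :
    M.IsSpherical (⋃ a ∈ J, p a) :=
  M.isSpherical_of_subset_descents (z := h.hom (M'.longest J)) <|
    Set.iUnion₂_subset fun _ ha =>
      h.subset_descents_hom_of_mem (M'.subset_descents_longest hJ ha)

/-- Composition of admissible families. -/
theorem comp {I'' : Type*} {M'' : CoxeterMatrix I''} {q : I'' → Set I'}
    (h : IsAdmissibleIn M' M p) (h' : IsAdmissibleIn M'' M' q) :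
    IsAdmissibleIn M'' M fun c => ⋃ a ∈ q c, p a where
  nonempty c := by
    obtain ⟨a, ha⟩ := h'.nonempty c
    exact (h.nonempty a).mono (Set.subset_biUnion_of_mem ha)
  spherical c := h.isSpherical_biUnion (h'.spherical c)
  ascents_or_descents w hw c := by
    -- The subgroup for the composed family is the image of the one for `q`, so each of its elements
    -- comes from an element to which the alternative for `q` applies.
    have hrange : (Set.range fun c => M.longest (⋃ a ∈ q c, p a)) =
        h.hom '' Set.range fun c => M'.longest (q c) := by
      rw [← Set.range_comp]
      congr 1
      ext c
      exact (h.hom_longest (h'.spherical c)).symm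
    rw [hrange, ← MonoidHom.map_closure] at hw
    obtain ⟨w', hw', rfl⟩ := hw
    refine (h'.ascents_or_descents w' hw' c).imp (fun hc => ?_) fun hc => ?_
    · exact Set.iUnion₂_subset fun a ha => h.subset_ascents_hom_of_mem (hc ha)
    · exact Set.iUnion₂_subset fun a ha => h.subset_descents_hom_of_mem (hc ha)
  type_eq c d := by
    rw [h'.type_eq, ← h.hom_longest (h'.spherical c), ← h.hom_longest (h'.spherical d),
      ← map_mul, orderOf_injective _ h.hom_injective]

/-- A reduced word of `w` gives the simple element of the image of `w`. -/
theorem prod_map_artinLongest (h : IsAdmissibleIn M' M p) {ω : List I'}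
    (hω : M'.len (M'.word ω) = ω.length) :
    (ω.map fun a => M.artinLongest (p a)).prod = M.simpleElt (h.hom (M'.word ω)) := by
  induction ω using List.reverseRecOn with
  | nil => simp [simpleElt_one]
  | append_singleton ω a ih =>
    have h1 := (M'.reduced_of_append hω).1
    have ha : a ∈ M'.ascents (M'.word ω) := by
      rw [mem_ascents, h1]
      simpa using hω
    rw [List.map_append, List.prod_append, ih h1, word_append, map_mul, word_cons, word_nil,
      mul_one, hom_simple, M.simpleElt_mul (h.len_hom_mul_simple ha)]
    simp [artinLongest]

/-- A morphism that sends the generators `s_a` to the lifts of the `r_{p a}` sends the lift of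
`r_J` to the lift of the longest element attached to the union of the blocks `p a`, `a ∈ J`. -/
theorem map_artinLongest (h : IsAdmissibleIn M' M p) {φ : M'.ArtinMonoid →* M.ArtinMonoid}
    (hφ : ∀ a, φ (M'.artinGen a) = M.artinLongest (p a)) {J : Set I'} (hJ : M'.IsSpherical J) :
    φ (M'.artinLongest J) = M.artinLongest (⋃ a ∈ J, p a) := by
  obtain ⟨ω, hω, hlen⟩ := M'.exists_word (M'.longest J)
  rw [artinLongest, artinLongest, ← h.hom_longest hJ, ← hω, M'.simpleElt_word hlen, map_list_prod,
    ← h.prod_map_artinLongest hlen, List.map_map]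
  congr 2
  ext a
  exact hφ a

/-- The lift of `r_J` is a product of generators, so the identity is already one in the monoid;
injectivity of `B⁺ → B` plays no role. -/
theorem map_artinMonoidToGroup_artinLongest (h : IsAdmissibleIn M' M p)
    {φ : M'.ArtinGroup →* M.ArtinGroup}
    (hφ : ∀ a, φ (M'.artinGroupGen a) = M.artinMonoidToGroup (M.artinLongest (p a))) {J : Set I'}
    (hJ : M'.IsSpherical J) :
    φ (M'.artinMonoidToGroup (M'.artinLongest J)) =
      M.artinMonoidToGroup (M.artinLongest (⋃ a ∈ J, p a)) := by
  obtain ⟨ω, hω, hlen⟩ := M'.exists_word (M'.longest J)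
  rw [artinLongest, artinLongest, ← h.hom_longest hJ, ← hω, M'.simpleElt_word hlen, map_list_prod,
    map_list_prod, ← h.prod_map_artinLongest hlen, map_list_prod, List.map_map, List.map_map,
    List.map_map]
  congr 2
  ext a
  exact hφ a

end IsAdmissibleIn

end Admissible

end CoxeterMatrix

namespace CoxeterMatrix

/-! ### Restriction to a subset of the index set -/

section Restrict

variable {I I' : Type*} {M' : CoxeterMatrix I'} {M : CoxeterMatrix I} {p : I' → Set I}

/-- The singletons `{j}`, `j ∈ J`, exhibit the Coxeter group of `Γ_J` inside that of `Γ`. -/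
theorem isAdmissibleIn_restrict (M : CoxeterMatrix I) (J : Set I) :
    IsAdmissibleIn (M.restrict J) M fun j : J => {(j : I)} where
  nonempty j := Set.singleton_nonempty _
  spherical j := M.isSpherical_of_subset_descents (z := M.simple j) <| by
    rintro _ rfl
    simp [mem_descents]
  ascents_or_descents w _ j := by
    rw [Set.singleton_subset_iff, Set.singleton_subset_iff]
    exact M.len_mul_simple w j
  -- Here `s_i s_j` must have order exactly `m_{i,j}`, not merely a divisor of it.
  type_eq i j := by
    rw [← simple_eq_longest, ← simple_eq_longest, orderOf_simple_mul_simple]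
    rfl

/-- The canonical morphism from the Coxeter group of `Γ_J` to that of `Γ`. -/
noncomputable def restrictHom (M : CoxeterMatrix I) (J : Set I) :
    (M.restrict J).Group →* M.Group :=
  (M.isAdmissibleIn_restrict J).hom

theorem restrictHom_injective (J : Set I) : Function.Injective (M.restrictHom J) :=
  (M.isAdmissibleIn_restrict J).hom_injective

theorem mem_ascents_restrictHom {J : Set I} {w : (M.restrict J).Group} {j : J} :
    (j : I) ∈ M.ascents (M.restrictHom J w) ↔ j ∈ (M.restrict J).ascents w := by
  rw [← Set.singleton_subset_iff]
  exact ⟨(M.isAdmissibleIn_restrict J).mem_ascents_of_subset,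
    (M.isAdmissibleIn_restrict J).subset_ascents_hom_of_mem⟩

theorem mem_descents_restrictHom {J : Set I} {w : (M.restrict J).Group} {j : J} :
    (j : I) ∈ M.descents (M.restrictHom J w) ↔ j ∈ (M.restrict J).descents w := by
  rw [← notMem_ascents_iff, ← notMem_ascents_iff, mem_ascents_restrictHom]

theorem biUnion_preimage_val {J α : Set I} (hα : α ⊆ J) :
    (⋃ j ∈ (Subtype.val ⁻¹' α : Set J), {(j : I)}) = α := by
  ext i
  simp only [Set.mem_iUnion, Set.mem_preimage, Set.mem_singleton_iff, exists_prop]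
  exact ⟨by rintro ⟨j, hj, rfl⟩; exact hj, fun hi => ⟨⟨i, hα hi⟩, hi, rfl⟩⟩

/-- In one direction `α` is a union of singleton blocks; in the other, `restrictHom` embeds one
parabolic subgroup into the other. -/
theorem isSpherical_preimage_val_iff {J α : Set I} (hα : α ⊆ J) :
    (M.restrict J).IsSpherical (Subtype.val ⁻¹' α) ↔ M.IsSpherical α := by
  constructor
  · intro h
    rw [← biUnion_preimage_val hα]
    exact (M.isAdmissibleIn_restrict J).isSpherical_biUnion h
  · intro h
    have : Finite (M.parabolic α) := h
    refine Finite.of_injective (β := M.parabolic α)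
      (fun w => ⟨M.restrictHom J w.1, ?_⟩) fun v w hvw => ?_
    · have := (M.isAdmissibleIn_restrict J).hom_mem_parabolic w.2
      rwa [biUnion_preimage_val hα] at this
    · exact Subtype.ext (restrictHom_injective J (congrArg Subtype.val hvw))

theorem restrictHom_longest {J α : Set I} (hα : α ⊆ J) (h : M.IsSpherical α) :
    M.restrictHom J ((M.restrict J).longest (Subtype.val ⁻¹' α)) = M.longest α := by
  rw [← isSpherical_preimage_val_iff hα] at h
  refine ((M.isAdmissibleIn_restrict J).hom_longest h).trans ?_
  rw [biUnion_preimage_val hα]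

theorem block_subset_ascents_iff {w : (M.restrict (⋃ a, p a)).Group} {a : I'} :
    block p a ⊆ (M.restrict (⋃ a, p a)).ascents w ↔
      p a ⊆ M.ascents (M.restrictHom (⋃ a, p a) w) :=
  ⟨fun h i hi => mem_ascents_restrictHom (j := ⟨i, Set.mem_iUnion_of_mem a hi⟩) |>.mpr (h hi),
    fun h _ hi => mem_ascents_restrictHom.mp (h hi)⟩

theorem block_subset_descents_iff {w : (M.restrict (⋃ a, p a)).Group} {a : I'} :
    block p a ⊆ (M.restrict (⋃ a, p a)).descents w ↔
      p a ⊆ M.descents (M.restrictHom (⋃ a, p a) w) :=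
  ⟨fun h i hi => mem_descents_restrictHom (j := ⟨i, Set.mem_iUnion_of_mem a hi⟩) |>.mpr (h hi),
    fun h _ hi => mem_descents_restrictHom.mp (h hi)⟩

theorem restrictHom_longest_block (h : ∀ a, M.IsSpherical (p a)) (a : I') :
    M.restrictHom (⋃ a, p a) ((M.restrict (⋃ a, p a)).longest (block p a)) = M.longest (p a) :=
  restrictHom_longest (Set.subset_iUnion p a) (h a)

theorem map_partitionSubgroup (h : ∀ a, M.IsSpherical (p a)) :
    ((M.restrict (⋃ a, p a)).partitionSubgroup (Set.range (block p))).map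
        (M.restrictHom (⋃ a, p a)) =
      Subgroup.closure (Set.range fun a => M.longest (p a)) := by
  rw [partitionSubgroup, MonoidHom.map_closure, ← Set.range_comp, ← Set.range_comp]
  congr 2
  ext a
  exact restrictHom_longest_block h a

theorem orderOf_longest_block (h : ∀ a, M.IsSpherical (p a)) (a b : I') :
    orderOf ((M.restrict (⋃ a, p a)).longest (block p a) *
        (M.restrict (⋃ a, p a)).longest (block p b)) =
      orderOf (M.longest (p a) * M.longest (p b)) := by
  rw [← orderOf_injective _ (restrictHom_injective (M := M) (⋃ a, p a)), map_mul,
    restrictHom_longest_block h, restrictHom_longest_block h]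

theorem subset_of_block_subset {a b : I'} (h : block p a ⊆ block p b) : p a ⊆ p b :=
  fun i hi => h (show (⟨i, Set.mem_iUnion_of_mem a hi⟩ : (⋃ b, p b : Set I)) ∈ block p a from hi)

/-- An admissible family is a pairwise disjoint family which is admissible in `Γ` itself. -/
theorem isAdmissibleFamily_iff :
    M'.IsAdmissibleFamily M p ↔ IsAdmissibleIn M' M p ∧ Pairwise (Function.onFun Disjoint p) := by
  constructor
  · intro h
    have hs : ∀ a, M.IsSpherical (p a) := fun a =>
      (isSpherical_preimage_val_iff (Set.subset_iUnion p a)).mp (h.admissible.spherical _ ⟨a, rfl⟩)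
    refine ⟨⟨fun a => ?_, hs, fun w hw a => ?_, fun a b => ?_⟩, fun a b hab => ?_⟩
    · rw [Set.nonempty_iff_ne_empty]
      intro he
      refine h.admissible.isPartition.1 ⟨a, ?_⟩
      rw [block, he, Set.preimage_empty]
    · rw [← map_partitionSubgroup hs] at hw
      obtain ⟨v, hv, rfl⟩ := hw
      rw [← block_subset_ascents_iff, ← block_subset_descents_iff]
      exact h.admissible.ascents_or_descents v hv _ ⟨a, rfl⟩
    · rw [h.type_eq]
      exact orderOf_longest_block hs a b
    · rw [Function.onFun, Set.disjoint_left]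
      intro i hia hib
      -- A common point lies in a unique block, and the injectivity of `p` then identifies the two
      -- indices.
      obtain ⟨β, -, hβ⟩ := h.admissible.isPartition.2 ⟨i, Set.mem_iUnion_of_mem a hia⟩
      have e : block p a = block p b :=
        (hβ _ ⟨⟨a, rfl⟩, hia⟩).trans (hβ _ ⟨⟨b, rfl⟩, hib⟩).symm
      exact hab (h.injective ((subset_of_block_subset e.subset).antisymm
        (subset_of_block_subset e.symm.subset)))
  · rintro ⟨h, hd⟩
    have hinj : ∀ {a b : I'} {i : I}, i ∈ p a → i ∈ p b → a = b := fun {a b i} hia hib => by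
      by_contra hab
      exact Set.disjoint_left.mp (hd hab) hia hib
    refine ⟨fun a b hab => ?_, ⟨⟨⟨?_, ?_⟩, ?_⟩, ?_⟩, fun a b => ?_⟩
    · obtain ⟨i, hi⟩ := h.nonempty a
      exact hinj hi (hab ▸ hi)
    · rintro ⟨a, ha⟩
      obtain ⟨i, hi⟩ := h.nonempty a
      have : (⟨i, Set.mem_iUnion_of_mem a hi⟩ : (⋃ b, p b : Set I)) ∈ block p a := hi
      rw [ha] at this
      exact this
    · rintro ⟨i, hi⟩
      obtain ⟨a, ha⟩ := Set.mem_iUnion.mp hi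
      refine ⟨block p a, ⟨⟨a, rfl⟩, ha⟩, ?_⟩
      rintro _ ⟨⟨b, rfl⟩, hb⟩
      rw [hinj hb ha]
    · rintro _ ⟨a, rfl⟩
      exact (isSpherical_preimage_val_iff (Set.subset_iUnion p a)).mpr (h.spherical a)
    · rintro w hw _ ⟨a, rfl⟩
      rw [block_subset_ascents_iff, block_subset_descents_iff]
      refine h.ascents_or_descents _ ?_ a
      rw [← map_partitionSubgroup h.spherical]
      exact ⟨w, hw, rfl⟩
    · rw [h.type_eq]
      exact (orderOf_longest_block h.spherical a b).symm

/-- Composition of admissible families. -/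
theorem IsAdmissibleFamily.comp {I'' : Type*} {M'' : CoxeterMatrix I''} {q : I'' → Set I'}
    (h : M'.IsAdmissibleFamily M p) (h' : M''.IsAdmissibleFamily M' q) :
    M''.IsAdmissibleFamily M fun c => ⋃ a ∈ q c, p a := by
  rw [isAdmissibleFamily_iff] at *
  refine ⟨h.1.comp h'.1, fun c d hcd => ?_⟩
  rw [Function.onFun, Set.disjoint_iUnion₂_left]
  intro a ha
  rw [Set.disjoint_iUnion₂_right]
  intro b hb
  refine h.2 fun hab => ?_
  exact Set.disjoint_left.mp (h'.2 hcd) ha (hab ▸ hb)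

theorem IsInducedBy.comp {I'' : Type*} {M'' : CoxeterMatrix I''} {q : I'' → Set I'}
    {φ : M'.ArtinMonoid →* M.ArtinMonoid} {φ' : M''.ArtinMonoid →* M'.ArtinMonoid}
    (h : IsInducedBy φ p) (h' : IsInducedBy φ' q) :
    IsInducedBy (φ.comp φ') fun c => ⋃ a ∈ q c, p a where
  family := h.family.comp h'.family
  map_gen c := by
    rw [MonoidHom.comp_apply, h'.map_gen]
    exact (isAdmissibleFamily_iff.mp h.family).1.map_artinLongest h.map_gen
      ((isAdmissibleFamily_iff.mp h'.family).1.spherical c)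

theorem IsGroupInducedBy.comp {I'' : Type*} {M'' : CoxeterMatrix I''} {q : I'' → Set I'}
    {φ : M'.ArtinGroup →* M.ArtinGroup} {φ' : M''.ArtinGroup →* M'.ArtinGroup}
    (h : IsGroupInducedBy φ p) (h' : IsGroupInducedBy φ' q) :
    IsGroupInducedBy (φ.comp φ') fun c => ⋃ a ∈ q c, p a where
  family := h.family.comp h'.family
  map_gen c := by
    rw [MonoidHom.comp_apply, h'.map_gen]
    exact (isAdmissibleFamily_iff.mp h.family).1.map_artinMonoidToGroup_artinLongest h.map_gen
      ((isAdmissibleFamily_iff.mp h'.family).1.spherical c)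

end Restrict

end CoxeterMatrix

theorem corollary3p19 {I I' I'' : Type*}
    (M : CoxeterMatrix I) (M' : CoxeterMatrix I') (M'' : CoxeterMatrix I'') :
    (∀ (φ : M'.ArtinMonoid →* M.ArtinMonoid) (φ' : M''.ArtinMonoid →* M'.ArtinMonoid),
      CoxeterMatrix.IsAdmissibleHom φ → CoxeterMatrix.IsAdmissibleHom φ' →
        CoxeterMatrix.IsAdmissibleHom (φ.comp φ')) ∧
    (∀ (φ : M'.ArtinMonoid →* M.ArtinMonoid) (φ' : M''.ArtinMonoid →* M'.ArtinMonoid)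
      (p : I' → Set I) (q : I'' → Set I'),
      CoxeterMatrix.IsInducedBy φ p → CoxeterMatrix.IsInducedBy φ' q →
        CoxeterMatrix.IsInducedBy (φ.comp φ') (fun c => ⋃ a ∈ q c, p a)) ∧
    (∀ (φ : M'.ArtinGroup →* M.ArtinGroup) (φ' : M''.ArtinGroup →* M'.ArtinGroup),
      CoxeterMatrix.IsAdmissibleGroupHom φ → CoxeterMatrix.IsAdmissibleGroupHom φ' →
        CoxeterMatrix.IsAdmissibleGroupHom (φ.comp φ')) ∧
    (∀ (φ : M'.ArtinGroup →* M.ArtinGroup) (φ' : M''.ArtinGroup →* M'.ArtinGroup)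
      (p : I' → Set I) (q : I'' → Set I'),
      CoxeterMatrix.IsGroupInducedBy φ p → CoxeterMatrix.IsGroupInducedBy φ' q →
        CoxeterMatrix.IsGroupInducedBy (φ.comp φ') (fun c => ⋃ a ∈ q c, p a)) :=
  ⟨fun _ _ ⟨_, h⟩ ⟨_, h'⟩ => ⟨_, h.comp h'⟩, fun _ _ _ _ h h' => h.comp h',
    fun _ _ ⟨_, h⟩ ⟨_, h'⟩ => ⟨_, h.comp h'⟩, fun _ _ _ _ h h' => h.comp h'⟩
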